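/- Let $W$ be a finite word of length $N$ (possibly empty) over an alphabet with at least two letters. For $n\ge 0$ let $P_W(n)$ be the number of distinct palindromic factors of $W$ of length $n$. Call $W$ Sturmian if it is a factor of an infinite Sturmian word over the alphabet, that is, of a one-sided infinite word having exactly $n+1$ distinct factors of length $n$ for every $n\ge 0$. A factor $u$ of $W$ is right special if $ua$ and $ub$ are factors of $W$ for two distinct letters $a,b$. Let $R_W$ be the smallest integer $p\ge 0$ such that $W$ has no right special factor of length $p$, and let $K_W$ be the length of the shortest unrepeated suffix of $W$, i.e. of the shortest suffix having exactly one occurrence in $W$. Call $W$ trapezoidal if $N=R_W+K_W$. Then the following three conditions are equivalent: (A') $W$ is a Sturmian palindrome (i.e. $W$ is Sturmian and a palindrome); (B') $P_W(n)+P_W(N-n)=2$ for each $0\le n\le N$; (C') $W$ is a trapezoidal palindrome (i.e. $W$ is trapezoidal and a palindrome). -/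

import Mathlib

namespace Words

variable {α : Type*}

/-- The factors of length `n` of the finite word `W`. -/
def factors (W : List α) (n : ℕ) : Set (List α) :=
  {u | u.length = n ∧ u <:+: W}

/-- Palindromic complexity `P_W(n)` of a finite word: the number of distinct palindromic factors
of length `n`. -/
noncomputable def palComplexity (W : List α) (n : ℕ) : ℕ :=
  {u ∈ factors W n | u.Palindrome}.ncard

/-- The block of length `n` starting at position `k` in the infinite word `s`. -/
def block (s : ℕ → α) (k n : ℕ) : List α :=
  List.ofFn fun i : Fin n => s (k + i)

/-- The factors of length `n` of the infinite word `s`. -/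
def infFactors (s : ℕ → α) (n : ℕ) : Set (List α) :=
  Set.range fun k => block s k n

/-- Subword complexity `C_s(n)` of an infinite word: the number of distinct factors of
length `n`. -/
noncomputable def infComplexity (s : ℕ → α) (n : ℕ) : ℕ :=
  (infFactors s n).ncard

/-- An infinite word is Sturmian if it has exactly `n + 1` factors of each length `n`. -/
def IsSturmianInf (s : ℕ → α) : Prop :=
  ∀ n, infComplexity s n = n + 1

/-- A finite word is Sturmian if it is a factor of an infinite Sturmian word. -/
def IsSturmian (W : List α) : Prop :=
  ∃ s : ℕ → α, IsSturmianInf s ∧ W ∈ infFactors s W.length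

/-- `u` is a right special factor of `W`: it can be extended to the right, inside `W`, by two
different letters. -/
def IsRightSpecial (W u : List α) : Prop :=
  ∃ a b : α, a ≠ b ∧ u ++ [a] <:+: W ∧ u ++ [b] <:+: W

/-- `u` is an unrepeated factor of `W`: it has exactly one occurrence in `W`. An occurrence is
recorded by the words that precede and follow it. -/
def IsUnrepeated (W u : List α) : Prop :=
  ∃! p : List α × List α, p.1 ++ u ++ p.2 = W

/-- `R_W`: the smallest `p` such that `W` has no right special factor of length `p`. -/
noncomputable def R (W : List α) : ℕ :=
  sInf {p | ¬ ∃ u : List α, u.length = p ∧ IsRightSpecial W u}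

/-- `K_W`: the length of the shortest unrepeated suffix of `W`. -/
noncomputable def K (W : List α) : ℕ :=
  sInf {k | ∃ u : List α, u.length = k ∧ u <:+ W ∧ IsUnrepeated W u}

/-- `W` is trapezoidal if `|W| = R_W + K_W`. -/
def IsTrapezoidal (W : List α) : Prop :=
  W.length = R W + K W

end Words

/-!
The equivalence rests on a description of trapezoidal words by right special factors. Counting the
factors of length `n + 1` of `W` by their prefixes of length `n`, and summing over `n`, shows that
`N - K_W` is the total number of right special factors, counted with the number of their right
extensions minus one. As there is a right special factor of each length below `R_W`, `W` is
trapezoidal if and only if it uses at most two letters and has at most one right special factor of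
each length (`isTrapezoidal_iff`, where this condition is `UniqueSplits`). An infinite Sturmian word
has exactly one right special factor of each length, so that its factors are trapezoidal.

Let now `W` be a trapezoidal palindrome. Its complexity at `n` is at most `n + 1`, and this forces
the stretch between two consecutive occurrences of a palindrome to be a palindrome
(`UniqueSplits.palAt_of_return`). There are two consequences.

* No palindrome `U` extends to factors `aUa` and `bUb` with `a ≠ b` (`UniqueSplits.noBranch`). Hence
  `W` is balanced (`NoBranch.balanced`, an argument of Coven and Hedlund), the numbers of `b` in its
  prefixes are the values of `⌊iθ + ρ⌋` for an irrational `θ` (`Balanced.exists_slope`), and `W` is a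
  factor of a mechanical word, which is Sturmian (`isSturmianInf_mechanical`).
* `W` has exactly `N + 1` palindromic factors (`UniqueSplits.sum_palComplexity`). As
  `P_W(n + 2) ≤ P_W(n)` in the absence of branching, this total leaves no choice but
  `P_W(n) + P_W(N - n) = 2` (`add_reflect_eq_two`).

Conversely, if the last identity holds, then `W` is a palindrome over at most two letters, and an
induction on the length shows that right special factors are unique: if `aS` and `bS` are both right
special, where `S` is the only right special factor of its length `n`, then `aSa` and `bSb` are
palindromes, and the identity makes room for a palindrome of length `n` other than `S` but not for
its palindromic extension (`exists_extension_of_unique`, `uniqueSplits_of_palComplexity`).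
-/

namespace Words

/-! ### Occurrences, palindromes and splits -/

section Positions

variable {β : Type*} {w : ℕ → β} {N : ℕ}

/-- The blocks of length `n` of `w` at positions `i` and `j` are the same word. -/
def Agree (w : ℕ → β) (i j n : ℕ) : Prop := ∀ t < n, w (i + t) = w (j + t)

/-- The block of length `n` of `w` at position `i` is a palindrome. -/
def PalAt (w : ℕ → β) (i n : ℕ) : Prop := ∀ s t, s + t + 1 = n → w (i + s) = w (i + t)

/-- The positions `i` and `j` witness a right special factor of length `n` of the first `N`
letters of `w`: the two blocks of length `n` are the same word, and are followed, inside the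
first `N` letters, by different letters. -/
def Split (w : ℕ → β) (N i j n : ℕ) : Prop :=
  i + n < N ∧ j + n < N ∧ Agree w i j n ∧ w (i + n) ≠ w (j + n)

/-- The first `N` letters of `w` use at most two letters, and have at most one right special
factor of each length. For words this is the same as being trapezoidal. -/
structure UniqueSplits (w : ℕ → β) (N : ℕ) : Prop where
  binary : ∃ a b, ∀ i < N, w i = a ∨ w i = b
  unique : ∀ n i j i' j', Split w N i j n → Split w N i' j' n → Agree w i i' n

theorem Agree.symm {i j n : ℕ} (h : Agree w i j n) : Agree w j i n := fun t ht => (h t ht).symm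

theorem Agree.trans {i j k n : ℕ} (h : Agree w i j n) (h' : Agree w j k n) : Agree w i k n :=
  fun t ht => (h t ht).trans (h' t ht)

theorem Agree.mono {i j m n : ℕ} (h : Agree w i j n) (hmn : m ≤ n) : Agree w i j m :=
  fun t ht => h t (by omega)

theorem Agree.succ {i j n : ℕ} (h : Agree w i j n) (h' : w (i + n) = w (j + n)) :
    Agree w i j (n + 1) := fun t ht => by
  rcases Nat.lt_succ_iff_lt_or_eq.1 ht with ht | rfl
  · exact h t ht
  · exact h'

theorem Agree.cons {i j n : ℕ} (h : Agree w (i + 1) (j + 1) n) (h' : w i = w j) :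
    Agree w i j (n + 1) := fun t ht => by
  rcases t with _ | t
  · exact h'
  · have := h t (by omega)
    rwa [show i + (t + 1) = i + 1 + t by omega, show j + (t + 1) = j + 1 + t by omega]

theorem Agree.shift {i j n : ℕ} (h : Agree w i j n) {k m : ℕ} (hk : k + m ≤ n) :
    Agree w (i + k) (j + k) m := fun t ht => by
  have := h (k + t) (by omega)
  rwa [← add_assoc, ← add_assoc] at this

theorem PalAt.congr {i j n : ℕ} (h : PalAt w i n) (h' : Agree w i j n) : PalAt w j n :=
  fun s t hst => by
    rw [← h' s (by omega), ← h' t (by omega)]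
    exact h s t hst

theorem Split.symm {i j n : ℕ} (h : Split w N i j n) : Split w N j i n :=
  ⟨h.2.1, h.1, h.2.2.1.symm, h.2.2.2.symm⟩

/-- The subword complexity of a word with unique splits is at most `n + 1`: pairwise distinct
blocks of length `n` number at most `n + 1`. -/
theorem UniqueSplits.card_le (hT : UniqueSplits w N) (n : ℕ) (S : Finset ℕ)
    (hS : ∀ i ∈ S, i + n ≤ N) (hd : ∀ i ∈ S, ∀ j ∈ S, Agree w i j n → i = j) :
    S.card ≤ n + 1 := by
  classical
  induction n generalizing S with
  | zero =>
    exact Finset.card_le_one.2 fun i hi j hj => hd i hi j hj fun t ht => absurd ht (by omega)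
  | succ n ih =>
    by_cases h : ∀ i ∈ S, ∀ j ∈ S, Agree w i j n → i = j
    · exact (ih S (fun i hi => by have := hS i hi; omega) h).trans (by omega)
    push Not at h
    obtain ⟨i, hi, j, hj, hij, hne⟩ := h
    obtain ⟨a, b, hab⟩ := hT.binary
    have key : ∀ k ∈ S, ∀ l ∈ S, k ≠ l → Agree w k l n → Split w N k l n := fun k hk l hl hkl h =>
      ⟨by have := hS k hk; omega, by have := hS l hl; omega, h,
        fun h' => hkl (hd k hk l hl (h.succ h'))⟩
    have hs := key i hi j hj hne hij
    -- a second coincidence at length `n` would be a split of the same word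
    have hE : (S.erase j).card ≤ n + 1 := by
      refine ih _ (fun k hk => by have := hS k (Finset.mem_of_mem_erase hk); omega) ?_
      intro k hk l hl hkl
      by_contra hne'
      obtain ⟨hkj, hk⟩ := Finset.mem_erase.1 hk
      obtain ⟨hlj, hl⟩ := Finset.mem_erase.1 hl
      have hs' := key k hk l hl hne' hkl
      have hik := hT.unique n _ _ _ _ hs hs'
      have hkj' : w (k + n) ≠ w (j + n) := fun h => hkj (hd k hk j hj
        ((hik.symm.trans hij).succ h))
      have hlj' : w (l + n) ≠ w (j + n) := fun h => hlj (hd l hl j hj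
        (((hik.trans hkl).symm.trans hij).succ h))
      have h1 := hab (k + n) hs'.1
      have h2 := hab (l + n) hs'.2.1
      have h3 := hab (j + n) hs.2.1
      have h4 := hs'.2.2.2
      grind
    rw [Finset.card_erase_of_mem hj] at hE
    omega

/-- In a palindrome with unique splits, the stretch between two consecutive occurrences of a
palindrome (both included) is a palindrome. Otherwise let `m` be the distance of the first
mismatch from the ends. The mismatch is a split of length `m`; all blocks of length `m + 1`
inside the stretch are distinct, since a repetition would propagate to the right up to the second
occurrence, and none of them is the mirror image of the last one. This makes at least `m + 3`
blocks of length `m + 1`. -/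
theorem UniqueSplits.palAt_of_return (hT : UniqueSplits w N) (hW : PalAt w 0 N) {p q l : ℕ}
    (hpq : p < q) (hq : q + l ≤ N) (hU : PalAt w p l) (hag : Agree w p q l)
    (hno : ∀ x, p < x → x < q → ¬ Agree w p x l) : PalAt w p (q + l - p) := by
  classical
  by_contra hcon
  unfold PalAt at hcon
  push Not at hcon
  obtain ⟨L, hL⟩ : ∃ L, L = q + l - p := ⟨_, rfl⟩
  have hex : ∃ s, s < L ∧ w (p + s) ≠ w (p + (L - 1 - s)) := by
    obtain ⟨s, t, hst, hne⟩ := hcon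
    exact ⟨s, by omega, by rwa [show L - 1 - s = t by omega]⟩
  obtain ⟨m, ⟨hmL, hm⟩, hmin⟩ : ∃ m, (m < L ∧ w (p + m) ≠ w (p + (L - 1 - m))) ∧
      ∀ t < m, w (p + t) = w (p + (L - 1 - t)) := by
    refine ⟨Nat.find hex, Nat.find_spec hex, fun t ht => ?_⟩
    by_contra h
    exact Nat.find_min hex ht ⟨ht.trans (Nat.find_spec hex).1, h⟩
  have hlm : l ≤ m := by
    by_contra h
    refine hm ((hU m (l - 1 - m) (by omega)).trans ((hag _ (by omega)).trans ?_))
    congr 1; omega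
  have h2m : 2 * m + 2 ≤ L := by
    by_contra h
    rcases Nat.lt_or_ge (L - 1 - m) m with h' | h'
    · have := hmin _ h'
      rw [show L - 1 - (L - 1 - m) = m by omega] at this
      exact hm this.symm
    · exact hm (by congr 2; omega)
  obtain ⟨p', hp'⟩ : ∃ p', p' = N - (q + l) := ⟨_, rfl⟩
  have hmir : ∀ t < L, w (p' + t) = w (p + (L - 1 - t)) := fun t ht => by
    have := hW (p' + t) (p + (L - 1 - t)) (by omega)
    simpa using this
  have hs : Split w N p p' m := by
    refine ⟨by omega, by omega, fun t ht => ?_, ?_⟩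
    · rw [hmir t (by omega), hmin t ht]
    · rwa [hmir m hmL]
  have hcard := hT.card_le (m + 1) (insert p' (Finset.Icc p (p + (L - m - 1)))) ?_ ?_
  · have hnot : p' ∉ Finset.Icc p (p + (L - m - 1)) := fun h => by
      rw [Finset.mem_Icc] at h
      rcases Nat.eq_or_lt_of_le h.1 with h' | h'
      · exact hs.2.2.2 (by rw [h'])
      · exact hno p' h' (by omega) (hs.2.2.1.mono hlm)
    rw [Finset.card_insert_of_notMem hnot, Nat.card_Icc] at hcard
    omega
  · intro i hi
    rw [Finset.mem_insert, Finset.mem_Icc] at hi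
    omega
  · have h1 : ∀ i ∈ Finset.Icc p (p + (L - m - 1)), ¬ Agree w i p' (m + 1) := fun i hi h => by
      rw [Finset.mem_Icc] at hi
      rcases Nat.eq_or_lt_of_le hi.1 with h' | h'
      · exact hs.2.2.2 (by rw [h']; exact h m (by omega))
      · exact hno i h' (by omega) ((hs.2.2.1.trans (h.mono (by omega)).symm).mono hlm)
    have h2 : ∀ i j, p ≤ i → i < j → j ≤ p + (L - m - 1) → ¬ Agree w i j (m + 1) := by
      intro i j hi hij hj h
      have hprop : ∀ e, j + e + m + 1 ≤ q + l → Agree w (i + e) (j + e) (m + 1) := by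
        intro e
        induction e with
        | zero => exact fun _ => h
        | succ e ih =>
          intro he
          have ih := ih (by omega)
          have ih' : Agree w (i + (e + 1)) (j + (e + 1)) m := ih.shift (k := 1) (by omega)
          refine ih'.succ ?_
          by_contra hne
          have := hT.unique m _ _ _ _ hs
            (Split.symm ⟨by omega, by omega, ih', hne⟩)
          exact hno (j + (e + 1)) (by omega) (by omega) (this.mono hlm)
      have hend := (hprop (q + l - (j + m + 1)) (by omega)).shift (k := m + 1 - l) (m := l)
        (by omega)
      rw [show j + (q + l - (j + m + 1)) + (m + 1 - l) = q by omega] at hend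
      exact hno _ (by omega) (by omega) (hag.trans hend.symm)
    intro i hi j hj hij
    rw [Finset.mem_insert] at hi hj
    rcases hi with rfl | hi <;> rcases hj with rfl | hj
    · rfl
    · exact absurd hij.symm (h1 j hj)
    · exact absurd hij (h1 i hi)
    · rw [Finset.mem_Icc] at hi hj
      rcases lt_trichotomy i j with h | h | h
      · exact absurd hij (h2 i j hi.1 h hj.2)
      · exact h
      · exact absurd hij.symm (h2 j i hj.1 h hi.2)

/-- A word is free of palindromic branching if no palindrome `U` has two distinct palindromic
extensions `aUa` and `bUb` inside it. -/
def NoBranch (w : ℕ → β) (N : ℕ) : Prop :=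
  ∀ p q n, p + n + 2 ≤ N → q + n + 2 ≤ N → Agree w (p + 1) (q + 1) n → PalAt w (p + 1) n →
    w p = w (p + n + 1) → w q = w (q + n + 1) → w p = w q

/-- Walking through the occurrences of `U` from `aUa` to `bUb`, the palindromic returns force an
occurrence of `aUb`; together with its mirror image `bUa` this makes both `aU` and `bU` right
special. -/
theorem UniqueSplits.noBranch (hT : UniqueSplits w N) (hW : PalAt w 0 N) : NoBranch w N := by
  classical
  intro p q n hp hq hag hpal hpp hqq
  wlog hpq : p < q generalizing p q
  · rcases Nat.eq_or_lt_of_le (Nat.le_of_not_lt hpq) with rfl | h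
    · rfl
    · exact (this q p hq hp hag.symm (hpal.congr hag) hqq hpp h).symm
  by_contra hne
  obtain ⟨x, hx, hmax⟩ : ∃ x ∈ (Finset.Ico p q).filter
      (fun x => Agree w (p + 1) (x + 1) n ∧ w x = w p), ∀ z ∈ (Finset.Ico p q).filter
      (fun x => Agree w (p + 1) (x + 1) n ∧ w x = w p), z ≤ x :=
    Finset.exists_max_image _ id
      ⟨p, Finset.mem_filter.2 ⟨Finset.mem_Ico.2 ⟨le_rfl, hpq⟩, fun _ _ => rfl, rfl⟩⟩
  simp only [Finset.mem_filter, Finset.mem_Ico] at hx hmax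
  obtain ⟨⟨hpx, hxq⟩, hxag, hxp⟩ := hx
  have hex : ∃ y, x < y ∧ Agree w (x + 1) (y + 1) n := ⟨q, hxq, hxag.symm.trans hag⟩
  obtain ⟨y, ⟨hxy, hyag⟩, hymin⟩ : ∃ y, (x < y ∧ Agree w (x + 1) (y + 1) n) ∧
      ∀ z < y, ¬ (x < z ∧ Agree w (x + 1) (z + 1) n) :=
    ⟨Nat.find hex, Nat.find_spec hex, fun z hz => Nat.find_min hex hz⟩
  have hyq : y ≤ q := by
    by_contra h
    exact hymin q (by omega) ⟨hxq, hxag.symm.trans hag⟩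
  have hwy : w y ≠ w p := by
    intro h
    rcases Nat.eq_or_lt_of_le hyq with rfl | h'
    · exact hne h.symm
    · have := hmax y ⟨⟨by omega, h'⟩, hxag.trans hyag, h⟩
      omega
  have hret := hT.palAt_of_return hW (p := x + 1) (q := y + 1) (l := n) (by omega) (by omega)
    (hpal.congr hxag) hyag (fun z h1 h2 h3 => by
      obtain ⟨z, rfl⟩ : ∃ z', z = z' + 1 := ⟨z - 1, by omega⟩
      exact hymin z (by omega) ⟨by omega, h3⟩)
  have hxr : w (x + (n + 1)) = w y := by
    have := hret n (y - x - 1) (by omega)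
    rwa [show x + 1 + n = x + (n + 1) by omega, show x + 1 + (y - x - 1) = y by omega] at this
  have hs : Split w N p x (n + 1) :=
    ⟨by omega, by omega, hxag.cons hxp.symm, by rw [hxr, ← add_assoc, ← hpp]; exact hwy.symm⟩
  have hyq' : w y = w q := by
    obtain ⟨a, b, hab⟩ := hT.binary
    have h1 := hab p (by omega)
    have h2 := hab q (by omega)
    have h3 := hab y (by omega)
    grind
  -- the mirror image of `aUb`
  obtain ⟨x', hx'⟩ : ∃ x', x' = N - (x + n + 2) := ⟨_, rfl⟩
  have hmir : ∀ t < n + 2, w (x' + t) = w (x + (n + 1 - t)) := fun t ht => by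
    have := hW (x' + t) (x + (n + 1 - t)) (by omega)
    simpa using this
  have hs' : Split w N q x' (n + 1) := by
    refine ⟨by omega, by omega, Agree.cons (fun t ht => ?_) ?_, ?_⟩
    · rw [add_assoc x', hmir (1 + t) (by omega), ← hag t ht, hxag t ht,
        (hpal.congr hxag) t (n - 1 - t) (by omega)]
      congr 1; omega
    · have := hmir 0 (by omega)
      rw [add_zero, Nat.sub_zero, hxr, hyq'] at this
      exact this.symm
    · rw [hmir (n + 1) (by omega), ← add_assoc, ← hqq, Nat.sub_self, add_zero, hxp]
      exact Ne.symm hne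
  exact hne (hT.unique _ _ _ _ _ hs hs' 0 (by omega))

end Positions

/-! ### Balance and slopes -/

section Balance

variable {β : Type*} {w : ℕ → β} {N : ℕ}

open Classical in
/-- The number of occurrences of the letter `b` among the first `k` letters of `w`. -/
noncomputable def count (w : ℕ → β) (b : β) (k : ℕ) : ℤ :=
  ∑ t ∈ Finset.range k, if w t = b then 1 else 0

theorem count_succ_of_eq {b : β} {k : ℕ} (h : w k = b) : count w b (k + 1) = count w b k + 1 := by
  rw [count, count, Finset.sum_range_succ, if_pos h]

theorem count_succ_of_ne {b : β} {k : ℕ} (h : w k ≠ b) : count w b (k + 1) = count w b k := by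
  rw [count, count, Finset.sum_range_succ, if_neg h, add_zero]

theorem count_add_le (b : β) (i n : ℕ) : count w b (i + n) ≤ count w b i + n := by
  induction n with
  | zero => simp
  | succ n ih =>
    rw [← add_assoc]
    push_cast
    by_cases h : w (i + n) = b
    · rw [count_succ_of_eq h]; omega
    · rw [count_succ_of_ne h]; omega

theorem le_count_add (b : β) (i n : ℕ) : count w b i ≤ count w b (i + n) := by
  induction n with
  | zero => simp
  | succ n ih =>
    rw [← add_assoc]
    by_cases h : w (i + n) = b
    · rw [count_succ_of_eq h]; omega
    · rw [count_succ_of_ne h]; omega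

/-- Any two blocks of length `n` in the first `N` letters have almost the same number of `b`. -/
def Balanced (w : ℕ → β) (N : ℕ) (b : β) : Prop :=
  ∀ n i j, i + n ≤ N → j + n ≤ N →
    count w b (i + n) - count w b i ≤ count w b (j + n) - count w b j + 1

/-- A word without palindromic branching is balanced: a shortest pair of unbalanced blocks has the
form `bUb`, `aUa`, and `U` is a palindrome, as a first mismatch between `U` and its mirror image
would give a shorter unbalanced pair. -/
theorem NoBranch.balanced (hN : NoBranch w N) {a b : β} (hab : a ≠ b)
    (hw : ∀ i < N, w i = a ∨ w i = b) : Balanced w N b := by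
  intro n
  induction n using Nat.strong_induction_on with
  | _ n ih =>
  intro i j hi hj
  by_contra hcon
  have hne : ∀ k < N, w k ≠ b ↔ w k = a := fun k hk => by
    have := hw k hk; grind
  obtain ⟨e, he⟩ : ∃ e : ℕ → ℤ, ∀ k, e k = (count w b (i + k) - count w b i) -
    (count w b (j + k) - count w b j) := ⟨_, fun _ => rfl⟩
  have hen : 2 ≤ e n := by rw [he]; omega
  have he0 : e 0 = 0 := by simp [he]
  have hdiff : ∀ k d, d < n → k + d ≤ n → e (k + d) ≤ e k + 1 := fun k d hd hkd => by
    have := ih d hd (i + k) (j + k) (by omega) (by omega)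
    rw [he, he]
    rw [← add_assoc, ← add_assoc]
    omega
  have hn2 : 2 ≤ n := by
    by_contra h
    have h1 := count_add_le (w := w) b i n
    have h2 := le_count_add (w := w) b j n
    rw [he] at hen
    omega
  have hmid : ∀ k, 1 ≤ k → k < n → e k = 1 := fun k h1 h2 => by
    have h3 := hdiff 0 k h2 (by omega)
    have h4 := hdiff k (n - k) (by omega) (by omega)
    rw [show k + (n - k) = n by omega] at h4
    rw [zero_add] at h3
    omega
  have hen' : e n = 2 := by
    have := hdiff (n - 1) 1 (by omega) (by omega)
    rw [show n - 1 + 1 = n by omega, hmid (n - 1) (by omega) (by omega)] at this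
    omega
  have hup : ∀ k < n, e (k + 1) = e k + 1 → w (i + k) = b ∧ w (j + k) = a := fun k hk h => by
    rw [he, he, ← add_assoc, ← add_assoc] at h
    by_cases h1 : w (i + k) = b <;> by_cases h2 : w (j + k) = b
    · rw [count_succ_of_eq h1, count_succ_of_eq h2] at h; omega
    · exact ⟨h1, (hne _ (by omega)).1 h2⟩
    · rw [count_succ_of_ne h1, count_succ_of_eq h2] at h; omega
    · rw [count_succ_of_ne h1, count_succ_of_ne h2] at h; omega
  have hflat : ∀ k < n, e (k + 1) = e k → w (i + k) = w (j + k) := fun k hk h => by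
    rw [he, he, ← add_assoc, ← add_assoc] at h
    by_cases h1 : w (i + k) = b <;> by_cases h2 : w (j + k) = b
    · rw [h1, h2]
    · rw [count_succ_of_eq h1, count_succ_of_ne h2] at h; omega
    · rw [count_succ_of_ne h1, count_succ_of_eq h2] at h; omega
    · rw [(hne _ (by omega)).1 h1, (hne _ (by omega)).1 h2]
  obtain ⟨hi0, hj0⟩ := hup 0 (by omega) (by rw [he0, hmid 1 (by omega) (by omega)]; rfl)
  obtain ⟨hi1, hj1⟩ := hup (n - 1) (by omega) (by
    rw [show n - 1 + 1 = n by omega, hen', hmid (n - 1) (by omega) (by omega)]; rfl)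
  rw [add_zero] at hi0 hj0
  have hag : Agree w (i + 1) (j + 1) (n - 2) := fun t ht => by
    have := hflat (1 + t) (by omega) (by
      rw [hmid _ (by omega) (by omega), hmid _ (by omega) (by omega)])
    rwa [← add_assoc, ← add_assoc] at this
  by_cases hpal : PalAt w (i + 1) (n - 2)
  · refine hab ?_
    have := hN i j (n - 2) (by omega) (by omega) hag hpal
      (by rw [hi0, show i + (n - 2) + 1 = i + (n - 1) by omega, hi1])
      (by rw [hj0, show j + (n - 2) + 1 = j + (n - 1) by omega, hj1])
    rw [← hi0, ← hj0, this]
  · unfold PalAt at hpal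
    push Not at hpal
    have hex : ∃ k, k < n - 2 ∧ w (i + 1 + k) ≠ w (i + 1 + (n - 3 - k)) := by
      obtain ⟨s, t, hst, h⟩ := hpal
      exact ⟨s, by omega, by rwa [show n - 3 - s = t by omega]⟩
    obtain ⟨k, ⟨hk, hkne⟩, hmin⟩ : ∃ k, (k < n - 2 ∧ w (i + 1 + k) ≠ w (i + 1 + (n - 3 - k))) ∧
        ∀ t < k, w (i + 1 + t) = w (i + 1 + (n - 3 - t)) := by
      classical
      refine ⟨Nat.find hex, Nat.find_spec hex, fun t ht => ?_⟩
      by_contra h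
      exact Nat.find_min hex ht ⟨ht.trans (Nat.find_spec hex).1, h⟩
    -- the first `k` letters of `U` and its last `k` letters contain the same number of `b`
    have hcount : ∀ m ≤ k, count w b (i + 1 + m) - count w b (i + 1) =
        count w b (i + n - 1) - count w b (i + n - 1 - m) := by
      intro m
      induction m with
      | zero => simp
      | succ m ihm =>
        intro hm
        have h1 := ihm (by omega)
        have h2 := hmin m (by omega)
        have h3 : i + n - 1 - m = (i + 1 + (n - 3 - m)) + 1 := by omega
        have h4 : i + n - 1 - (m + 1) = i + 1 + (n - 3 - m) := by omega
        rw [h4, ← add_assoc]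
        rw [h3] at h1
        by_cases h5 : w (i + 1 + m) = b
        · rw [count_succ_of_eq h5]
          rw [count_succ_of_eq (h2.symm.trans h5)] at h1
          omega
        · rw [count_succ_of_ne h5]
          rw [count_succ_of_ne (fun h => h5 (h2.trans h))] at h1
          omega
    have hcount := hcount k le_rfl
    have hbl : ∀ m, 1 ≤ m → m < n →
        count w b (i + m) - count w b i = count w b (j + m) - count w b j + 1 := fun m h1 h2 => by
      have := hmid m h1 h2
      rw [he] at this
      omega
    have e2 := hbl (1 + k) (by omega) (by omega)
    have e4 := hbl (n - 1 - k) (by omega) (by omega)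
    have e6 : count w b (i + n) = count w b (i + (n - 1)) + 1 := by
      rw [← count_succ_of_eq hi1]; congr 1; omega
    have e7 : count w b (j + n) = count w b (j + (n - 1)) := by
      rw [← count_succ_of_ne ((hne _ (by omega)).2 hj1)]; congr 1; omega
    have e8 : count w b (i + 1) = count w b i + 1 := count_succ_of_eq hi0
    have hl := hag k hk
    have hr := hag (n - 3 - k) (by omega)
    have r1 : i + n - 1 - k = i + (n - 1 - k) := by omega
    have r2 : i + n - 1 = i + (n - 1) := by omega
    rw [r1, r2, add_assoc i 1 k] at hcount
    have q1 : i + 1 + k = i + (1 + k) := by omega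
    have q2 : i + 1 + (n - 3 - k) = i + (n - 2 - k) := by omega
    have q3 : j + 1 + k = j + (1 + k) := by omega
    have q4 : j + 1 + (n - 3 - k) = j + (n - 2 - k) := by omega
    rw [q1, q3] at hl
    rw [q2, q4] at hr
    rw [q1, q2] at hkne
    by_cases hb : w (i + (1 + k)) = b
    · have hb' := hkne; rw [hb] at hb'
      have f1 := count_succ_of_eq hb
      have f2 := count_succ_of_ne (hr ▸ hb'.symm)
      have := ih (k + 2) (by omega) i (j + (n - 2 - k)) (by omega) (by omega)
      rw [show j + (n - 2 - k) + (k + 2) = j + n by omega,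
        show i + (k + 2) = i + (1 + k) + 1 by omega] at this
      rw [show j + (n - 2 - k) + 1 = j + (n - 1 - k) by omega] at f2
      omega
    · have hb' : w (i + (n - 2 - k)) = b := by
        have h1 := hw (i + (1 + k)) (by omega)
        have h2 := hw (i + (n - 2 - k)) (by omega)
        grind
      have f1 := count_succ_of_ne (hl ▸ hb)
      have f2 := count_succ_of_eq hb'
      have := ih (k + 2) (by omega) (i + (n - 2 - k)) j (by omega) (by omega)
      rw [show i + (n - 2 - k) + (k + 2) = i + n by omega,
        show j + (k + 2) = j + (1 + k) + 1 by omega] at this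
      rw [show i + (n - 2 - k) + 1 = i + (n - 1 - k) by omega] at f2
      omega

/-- In a balanced word, `(B - 1) / k < (B' + 1) / l` whenever `B` and `B'` are the numbers of `b` in
blocks of lengths `k` and `l`. The proof is the subtractive Euclidean algorithm on `k` and `l`. -/
theorem Balanced.slope_lt {b : β} (hb : Balanced w N b) :
    ∀ s k l i j : ℕ, k + l ≤ s → 0 < k → 0 < l → i + k ≤ N → j + l ≤ N →
      l * (count w b (i + k) - count w b i - 1) < k * (count w b (j + l) - count w b j + 1) := by
  intro s
  induction s with
  | zero => intros; omega
  | succ s ih =>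
    intro k l i j hs hk hl hi hj
    rcases lt_trichotomy k l with h | rfl | h
    · obtain ⟨d, rfl⟩ : ∃ d, l = k + d := ⟨l - k, by omega⟩
      have h1 := ih k d i (j + k) (by omega) hk (by omega) hi (by omega)
      have h2 := hb k i j hi (by omega)
      rw [← add_assoc]
      push_cast
      nlinarith [mul_le_mul_of_nonneg_left h2 (Int.natCast_nonneg k)]
    · have h2 := hb k i j hi hj
      have : (0 : ℤ) < k := by omega
      nlinarith
    · obtain ⟨d, rfl⟩ : ∃ d, k = l + d := ⟨k - l, by omega⟩
      have h1 := ih d l (i + l) j (by omega) (by omega) hl (by omega) hj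
      have h2 := hb l i j (by omega) hj
      rw [← add_assoc]
      push_cast
      nlinarith [mul_le_mul_of_nonneg_left h2 (Int.natCast_nonneg l)]

/-- The prefix counts of a balanced word are the integer parts of an affine function whose slope
is irrational and lies in `(0, 1)`. -/
theorem Balanced.exists_slope {b : β} (hb : Balanced w N b) :
    ∃ θ ρ : ℝ, Irrational θ ∧ 0 < θ ∧ θ < 1 ∧ ∀ i ≤ N, ⌊i * θ + ρ⌋ = count w b i := by
  classical
  let I : Finset (ℕ × ℕ) :=
    ((Finset.range (N + 1)) ×ˢ (Finset.Icc 1 N)).filter fun x => x.1 + x.2 ≤ N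
  have hI : ∀ x ∈ I, 0 < x.2 ∧ x.1 + x.2 ≤ N := fun x hx => by
    simp only [I, Finset.mem_filter, Finset.mem_product, Finset.mem_Icc] at hx; omega
  have hI' : ∀ i k, 0 < k → i + k ≤ N → (i, k) ∈ I := fun i k h1 h2 => by
    simp only [I, Finset.mem_filter, Finset.mem_product, Finset.mem_Icc, Finset.mem_range]; omega
  let lo : Finset ℝ := insert 0
    (I.image fun x => ((count w b (x.1 + x.2) - count w b x.1 - 1 : ℤ) : ℝ) / x.2)
  let hi : Finset ℝ := insert 1
    (I.image fun x => ((count w b (x.1 + x.2) - count w b x.1 + 1 : ℤ) : ℝ) / x.2)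
  have hlohi : ∀ x ∈ lo, ∀ y ∈ hi, x < y := by
    intro x hx y hy
    rcases Finset.mem_insert.1 hx with rfl | hx <;> rcases Finset.mem_insert.1 hy with rfl | hy
    · exact one_pos
    · obtain ⟨⟨j, l⟩, hp, rfl⟩ := Finset.mem_image.1 hy
      obtain ⟨h1, h2⟩ := hI _ hp
      have h3 := le_count_add (w := w) b j l
      have : (0 : ℤ) < count w b (j + l) - count w b j + 1 := by omega
      exact div_pos (by exact_mod_cast this) (by exact_mod_cast h1)
    · obtain ⟨⟨j, l⟩, hp, rfl⟩ := Finset.mem_image.1 hx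
      obtain ⟨h1, h2⟩ := hI _ hp
      have h3 := count_add_le (w := w) b j l
      have : count w b (j + l) - count w b j - 1 < (l : ℤ) := by omega
      rw [div_lt_one (by exact_mod_cast h1)]
      exact_mod_cast this
    · obtain ⟨⟨i, k⟩, hp, rfl⟩ := Finset.mem_image.1 hx
      obtain ⟨⟨j, l⟩, hq, rfl⟩ := Finset.mem_image.1 hy
      obtain ⟨h1, h2⟩ := hI _ hp
      obtain ⟨h3, h4⟩ := hI _ hq
      have := hb.slope_lt _ k l i j le_rfl h1 h3 h2 h4
      rw [div_lt_div_iff₀ (by exact_mod_cast h1) (by exact_mod_cast h3), mul_comm,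
        mul_comm (_ : ℝ) (k : ℝ)]
      exact_mod_cast this
  obtain ⟨m₁, hm₁, hm₁'⟩ := Order.exists_between_finsets lo hi hlohi
  obtain ⟨m₂, hm₂, hm₂'⟩ := Order.exists_between_finsets (insert m₁ lo) hi (by
    intro x hx y hy
    rcases Finset.mem_insert.1 hx with rfl | hx
    · exact hm₁' y hy
    · exact hlohi x hx y hy)
  obtain ⟨θ, hθ, hθ1, hθ2⟩ := exists_irrational_btwn (hm₂ m₁ (Finset.mem_insert_self _ _))
  have hlo : ∀ x ∈ lo, x < θ := fun x hx => (hm₁ x hx).trans hθ1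
  have hhi : ∀ y ∈ hi, θ < y := fun y hy => hθ2.trans (hm₂' y hy)
  have hwin : ∀ i k, 0 < k → i + k ≤ N →
      ((count w b (i + k) : ℝ) - count w b i - 1 < k * θ) ∧
      (k * θ < (count w b (i + k) : ℝ) - count w b i + 1) := by
    intro i k h1 h2
    have h3 := hlo _ (Finset.mem_insert_of_mem (Finset.mem_image_of_mem _ (hI' i k h1 h2)))
    have h4 := hhi _ (Finset.mem_insert_of_mem (Finset.mem_image_of_mem _ (hI' i k h1 h2)))
    have hk : (0 : ℝ) < k := by exact_mod_cast h1
    rw [div_lt_iff₀ hk] at h3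
    rw [lt_div_iff₀ hk] at h4
    push_cast at h3 h4
    constructor <;> linarith
  obtain ⟨ρ, hρ, hρ'⟩ := Order.exists_between_finsets
    ((Finset.range (N + 1)).image fun i : ℕ => (count w b i : ℝ) - i * θ)
    ((Finset.range (N + 1)).image fun i : ℕ => (count w b i : ℝ) + 1 - i * θ) (by
      intro x hx y hy
      obtain ⟨i, hi, rfl⟩ := Finset.mem_image.1 hx
      obtain ⟨j, hj, rfl⟩ := Finset.mem_image.1 hy
      rw [Finset.mem_range] at hi hj
      rcases lt_trichotomy i j with h | rfl | h
      · obtain ⟨d, rfl⟩ : ∃ d, j = i + d := ⟨j - i, by omega⟩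
        have := (hwin i d (by omega) (by omega)).2
        push_cast
        linarith
      · linarith
      · obtain ⟨d, rfl⟩ : ∃ d, i = j + d := ⟨i - j, by omega⟩
        have := (hwin j d (by omega) (by omega)).1
        push_cast
        linarith)
  refine ⟨θ, ρ, hθ, hlo 0 (Finset.mem_insert_self _ _), hhi 1 (Finset.mem_insert_self _ _),
    fun i hi => ?_⟩
  have hmem : i ∈ Finset.range (N + 1) := Finset.mem_range.2 (by omega)
  have h1 := hρ _ (Finset.mem_image_of_mem _ hmem)
  have h2 := hρ' _ (Finset.mem_image_of_mem _ hmem)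
  rw [Int.floor_eq_iff]
  constructor <;> linarith

end Balance

/-! ### Mechanical words are Sturmian -/

section Mechanical

variable {α : Type*}

theorem block_eq_block {s : ℕ → α} {i j n : ℕ} : block s i n = block s j n ↔ Agree s i j n := by
  unfold block
  rw [List.ofFn_inj, funext_iff]
  exact ⟨fun h t ht => h ⟨t, ht⟩, fun h t => h t t.2⟩

/-- The lower mechanical word of slope `θ` and intercept `ρ`, written with the letters `a` (no
integer is passed) and `b`. -/
noncomputable def mechanical (θ ρ : ℝ) (a b : α) (n : ℕ) : α :=
  if ⌊((n + 1 : ℕ) : ℝ) * θ + ρ⌋ = ⌊(n : ℝ) * θ + ρ⌋ then a else b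

variable {θ ρ : ℝ} {a b : α}

theorem floor_step (h0 : 0 < θ) (h1 : θ < 1) (n : ℕ) :
    ⌊((n + 1 : ℕ) : ℝ) * θ + ρ⌋ = ⌊(n : ℝ) * θ + ρ⌋ ∨
      ⌊((n + 1 : ℕ) : ℝ) * θ + ρ⌋ = ⌊(n : ℝ) * θ + ρ⌋ + 1 := by
  have h2 : ((n + 1 : ℕ) : ℝ) * θ + ρ = (n : ℝ) * θ + ρ + θ := by push_cast; ring
  have h3 : ⌊(n : ℝ) * θ + ρ⌋ ≤ ⌊((n + 1 : ℕ) : ℝ) * θ + ρ⌋ := Int.floor_mono (by linarith)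
  have h4 : ⌊((n + 1 : ℕ) : ℝ) * θ + ρ⌋ ≤ ⌊(n : ℝ) * θ + ρ⌋ + 1 := by
    rw [← Int.floor_add_one]; exact Int.floor_mono (by linarith)
  omega

theorem mechanical_eq_iff (h0 : 0 < θ) (h1 : θ < 1) (hab : a ≠ b) (i j : ℕ) :
    mechanical θ ρ a b i = mechanical θ ρ a b j ↔
      ⌊((i + 1 : ℕ) : ℝ) * θ + ρ⌋ - ⌊(i : ℝ) * θ + ρ⌋ =
        ⌊((j + 1 : ℕ) : ℝ) * θ + ρ⌋ - ⌊(j : ℝ) * θ + ρ⌋ := by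
  have h2 := floor_step (ρ := ρ) h0 h1 i
  have h3 := floor_step (ρ := ρ) h0 h1 j
  unfold mechanical
  split_ifs
  · exact iff_of_true rfl (by omega)
  · exact iff_of_false hab (by omega)
  · exact iff_of_false hab.symm (by omega)
  · exact iff_of_true rfl (by omega)

theorem agree_mechanical_iff (h0 : 0 < θ) (h1 : θ < 1) (hab : a ≠ b) (i j n : ℕ) :
    Agree (mechanical θ ρ a b) i j n ↔ ∀ t ≤ n,
      ⌊((i + t : ℕ) : ℝ) * θ + ρ⌋ - ⌊(i : ℝ) * θ + ρ⌋ =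
        ⌊((j + t : ℕ) : ℝ) * θ + ρ⌋ - ⌊(j : ℝ) * θ + ρ⌋ := by
  constructor
  · intro h t
    induction t with
    | zero => simp
    | succ t ih =>
      intro ht
      have h2 := ih (by omega)
      have h3 := (mechanical_eq_iff h0 h1 hab _ _).1 (h t (by omega))
      rw [← add_assoc, ← add_assoc]
      omega
  · intro h t ht
    rw [mechanical_eq_iff h0 h1 hab]
    have h2 := h t (by omega)
    have h3 := h (t + 1) (by omega)
    rw [← add_assoc, ← add_assoc] at h3
    omega

/-- A block of length `n` at `k` is determined by the integers `⌊x + tθ⌋`, `t ≤ n`, where `x` is the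
fractional part of `kθ + ρ`. They increase with `x`, by at most one each, so that their sum takes at
most `n + 1` values and determines all of them. -/
theorem exists_injOn_sum (h0 : 0 < θ) (h1 : θ < 1) (hab : a ≠ b) (n : ℕ) :
    ∃ (f : List α → ℤ) (A : ℤ),
      Set.MapsTo f (infFactors (mechanical θ ρ a b) n) (Finset.Icc A (A + n)) ∧
        Set.InjOn f (infFactors (mechanical θ ρ a b) n) := by
  have hdiff : ∀ k t : ℕ, ⌊((k + t : ℕ) : ℝ) * θ + ρ⌋ - ⌊(k : ℝ) * θ + ρ⌋ =
      ⌊Int.fract ((k : ℝ) * θ + ρ) + t * θ⌋ := fun k t => by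
    rw [← Int.floor_sub_intCast, Int.fract]
    congr 1
    push_cast
    ring
  let G : ℕ → ℤ := fun k => ∑ t ∈ Finset.range (n + 1), ⌊Int.fract ((k : ℝ) * θ + ρ) + t * θ⌋
  have hGinj : ∀ i j : ℕ, Int.fract ((i : ℝ) * θ + ρ) ≤ Int.fract ((j : ℝ) * θ + ρ) → G i = G j →
      Agree (mechanical θ ρ a b) i j n := by
    intro i j hle hG
    rw [agree_mechanical_iff h0 h1 hab]
    have hmono : ∀ t ∈ Finset.range (n + 1), ⌊Int.fract ((i : ℝ) * θ + ρ) + t * θ⌋ ≤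
        ⌊Int.fract ((j : ℝ) * θ + ρ) + t * θ⌋ := fun t _ => Int.floor_mono (by linarith)
    intro t ht
    rw [hdiff, hdiff]
    exact (Finset.sum_eq_sum_iff_of_le hmono).1 hG t (Finset.mem_range.2 (by omega))
  have hGmem : ∀ k, G k ∈ Finset.Icc (∑ t ∈ Finset.range (n + 1), ⌊(t : ℝ) * θ⌋)
      (∑ t ∈ Finset.range (n + 1), ⌊(t : ℝ) * θ⌋ + n) := by
    intro k
    have hf0 := Int.fract_nonneg ((k : ℝ) * θ + ρ)
    have hf1 := Int.fract_lt_one ((k : ℝ) * θ + ρ)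
    rw [Finset.mem_Icc]
    refine ⟨Finset.sum_le_sum fun t _ => Int.floor_mono (by linarith), ?_⟩
    have hz : ⌊Int.fract ((k : ℝ) * θ + ρ) + ((0 : ℕ) : ℝ) * θ⌋ = 0 := by simp
    have hz' : ⌊((0 : ℕ) : ℝ) * θ⌋ = 0 := by simp
    simp only [G]
    rw [Finset.sum_range_succ', Finset.sum_range_succ', hz, hz', add_zero, add_zero]
    have : ∑ t ∈ Finset.range n, ⌊Int.fract ((k : ℝ) * θ + ρ) + ((t + 1 : ℕ) : ℝ) * θ⌋ ≤
        ∑ t ∈ Finset.range n, (⌊((t + 1 : ℕ) : ℝ) * θ⌋ + 1) :=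
      Finset.sum_le_sum fun t _ => by
        rw [← Int.floor_add_one]; exact Int.floor_mono (by linarith)
    rw [Finset.sum_add_distrib] at this
    simpa using this
  choose! idx hidx using fun (u : List α) (hu : u ∈ infFactors (mechanical θ ρ a b) n) => hu
  refine ⟨fun u => G (idx u), _, fun u _ => hGmem _, fun u hu v hv huv => ?_⟩
  rw [← hidx u hu, ← hidx v hv]
  simp only
  rw [block_eq_block]
  rcases le_total (Int.fract ((idx u : ℝ) * θ + ρ)) (Int.fract ((idx v : ℝ) * θ + ρ)) with h | h
  · exact hGinj _ _ h huv
  · exact (hGinj _ _ h huv.symm).symm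

/-- The floor function `n ↦ ⌊nθ + ρ⌋` of an irrational slope has no eventually periodic
differences. -/
theorem not_eventually_periodic (hθ : Irrational θ) {i p : ℕ} (hp : 0 < p)
    (h : ∀ t : ℕ, ⌊((i + t : ℕ) : ℝ) * θ + ρ⌋ - ⌊(i : ℝ) * θ + ρ⌋ =
      ⌊((i + p + t : ℕ) : ℝ) * θ + ρ⌋ - ⌊((i + p : ℕ) : ℝ) * θ + ρ⌋) : False := by
  obtain ⟨c, hc⟩ : ∃ c, c = ⌊((i + p : ℕ) : ℝ) * θ + ρ⌋ - ⌊(i : ℝ) * θ + ρ⌋ := ⟨_, rfl⟩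
  have hk : ∀ k : ℕ, ⌊((i + k * p : ℕ) : ℝ) * θ + ρ⌋ = ⌊(i : ℝ) * θ + ρ⌋ + k * c := by
    intro k
    induction k with
    | zero => simp
    | succ k ih =>
      have := h (k * p)
      rw [show i + (k + 1) * p = i + p + k * p by ring]
      push_cast at *
      linarith
  have hne : (p : ℝ) * θ - c ≠ 0 := fun h0 => by
    refine hθ ⟨(c : ℚ) / p, ?_⟩
    have : (p : ℝ) ≠ 0 := by exact_mod_cast hp.ne'
    push_cast
    rw [div_eq_iff this]
    linarith
  obtain ⟨k, hk'⟩ := exists_nat_gt (1 / |(p : ℝ) * θ - c|)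
  rw [div_lt_iff₀ (abs_pos.2 hne)] at hk'
  have h1 := Int.floor_le ((i : ℝ) * θ + ρ)
  have h2 := Int.lt_floor_add_one ((i : ℝ) * θ + ρ)
  have h3 := Int.floor_le (((i + k * p : ℕ) : ℝ) * θ + ρ)
  have h4 := Int.lt_floor_add_one (((i + k * p : ℕ) : ℝ) * θ + ρ)
  rw [hk] at h3 h4
  push_cast at h3 h4
  rw [← Nat.abs_cast k, ← abs_mul, lt_abs] at hk'
  rcases hk' with hk' | hk' <;> nlinarith

theorem isSturmianInf_mechanical (hθ : Irrational θ) (h0 : 0 < θ) (h1 : θ < 1) (hab : a ≠ b) :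
    IsSturmianInf (mechanical θ ρ a b) := by
  have hfin : ∀ n, (infFactors (mechanical θ ρ a b) n).Finite := fun n => by
    obtain ⟨f, A, hm, hi⟩ := exists_injOn_sum (ρ := ρ) h0 h1 hab n
    exact Set.Finite.of_injOn hm hi (Finset.finite_toSet _)
  have hle : ∀ n, infComplexity (mechanical θ ρ a b) n ≤ n + 1 := fun n => by
    obtain ⟨f, A, hm, hi⟩ := exists_injOn_sum (ρ := ρ) h0 h1 hab n
    have := Set.ncard_le_ncard_of_injOn f hm hi (Finset.finite_toSet _)
    rw [Set.ncard_coe_finset, Int.card_Icc] at this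
    unfold infComplexity
    omega
  have hlt : ∀ n, infComplexity (mechanical θ ρ a b) n <
      infComplexity (mechanical θ ρ a b) (n + 1) := by
    -- otherwise each block of length `n` determines the next letter
    intro n
    by_contra hcon
    have htake : ∀ k, (block (mechanical θ ρ a b) k (n + 1)).take n =
        block (mechanical θ ρ a b) k n := fun k => by
      refine List.ext_getElem (by simp [block]) fun i _ _ => ?_
      simp only [block, List.getElem_take, List.getElem_ofFn]
    have hinj : ∀ i j, Agree (mechanical θ ρ a b) i j n →
        Agree (mechanical θ ρ a b) i j (n + 1) := by
      intro i j hij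
      rw [← block_eq_block] at hij ⊢
      refine Set.inj_on_of_surj_on_of_ncard_le (s := infFactors (mechanical θ ρ a b) (n + 1))
        (t := infFactors (mechanical θ ρ a b) n) (fun u _ => u.take n) ?_ ?_
        (Nat.le_of_not_lt hcon) ⟨i, rfl⟩ ⟨j, rfl⟩ ?_ (hfin _)
      · rintro _ ⟨k, rfl⟩
        exact ⟨k, (htake k).symm⟩
      · rintro _ ⟨k, rfl⟩
        exact ⟨_, ⟨k, rfl⟩, htake k⟩
      · simp only [htake, hij]
    have : Finite (infFactors (mechanical θ ρ a b) n) := hfin n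
    obtain ⟨i, j, hne, hij⟩ := Finite.exists_ne_map_eq_of_infinite
      fun k : ℕ => (⟨block (mechanical θ ρ a b) k n, k, rfl⟩ :
        infFactors (mechanical θ ρ a b) n)
    replace hij := block_eq_block.1 (congrArg Subtype.val hij)
    wlog hlt : i < j generalizing i j
    · exact this j i hne.symm hij.symm (by omega)
    have hall : ∀ t, Agree (mechanical θ ρ a b) (i + t) (j + t) n := by
      intro t
      induction t with
      | zero => exact hij
      | succ t ih => exact (hinj _ _ ih).shift (k := 1) (by omega)
    have hall' : ∀ m, Agree (mechanical θ ρ a b) i j m := fun m t _ =>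
      hinj _ _ (hall t) 0 (by omega)
    refine not_eventually_periodic (ρ := ρ) (i := i) (p := j - i) hθ (by omega) fun t => ?_
    rw [show i + (j - i) = j by omega]
    exact (agree_mechanical_iff h0 h1 hab i j t).1 (hall' t) t le_rfl
  have hge : ∀ n, n + 1 ≤ infComplexity (mechanical θ ρ a b) n := by
    intro n
    induction n with
    | zero => exact (Set.ncard_pos (hfin 0)).2 ⟨_, 0, rfl⟩
    | succ n ih => exact Nat.succ_le_of_lt (ih.trans_lt (hlt n))
  exact fun n => le_antisymm (hle n) (hge n)

/-- A balanced finite word over two letters is a factor of a Sturmian word. -/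
theorem isSturmian_of_balanced {W : List α} {a b : α} (hab : a ≠ b) (hW : ∀ x ∈ W, x = a ∨ x = b)
    (hb : Balanced (fun i => W[i]?) W.length (some b)) : IsSturmian W := by
  obtain ⟨θ, ρ, hθ, h0, h1, hfl⟩ := hb.exists_slope
  refine ⟨mechanical θ ρ a b, isSturmianInf_mechanical hθ h0 h1 hab, 0, ?_⟩
  refine List.ext_getElem (by simp [block]) fun i hi hi' => ?_
  simp only [block, List.getElem_ofFn, zero_add, mechanical]
  rw [hfl i hi'.le, hfl (i + 1) hi']
  by_cases h : W[i] = b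
  · rw [count_succ_of_eq (by simp [hi', h]), if_neg (by omega), h]
  · rw [count_succ_of_ne (by simp [hi', h]), if_pos rfl]
    exact ((hW _ (List.getElem_mem hi')).resolve_right h).symm

end Mechanical

/-! ### Factors of finite words as blocks at positions -/

section Factors

variable {α : Type*} {W : List α}

/-- The letters of `W` as a function of the position; it takes the value `none` from the position
`W.length` on. -/
def letter (W : List α) (i : ℕ) : Option α := W[i]?

/-- The factor of `W` of length `n` at position `i`; shorter if `W` ends earlier. -/
def sub (W : List α) (i n : ℕ) : List α := (W.drop i).take n

theorem letter_eq_getElem {i : ℕ} (h : i < W.length) : letter W i = some W[i] :=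
  List.getElem?_eq_getElem h

theorem length_sub {i n : ℕ} (h : i + n ≤ W.length) : (sub W i n).length = n := by
  simp only [sub, List.length_take, List.length_drop]; omega

theorem getElem?_sub {i n t : ℕ} (h : t < n) : (sub W i n)[t]? = letter W (i + t) := by
  simp [sub, letter, h]

theorem sub_eq_sub {i j n : ℕ} (hi : i + n ≤ W.length) (hj : j + n ≤ W.length) :
    sub W i n = sub W j n ↔ Agree (letter W) i j n := by
  constructor
  · intro h t ht
    rw [← getElem?_sub ht, h, getElem?_sub ht]
  · intro h
    refine List.ext_getElem? fun t => ?_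
    rcases Nat.lt_or_ge t n with ht | ht
    · rw [getElem?_sub ht, getElem?_sub ht, h t ht]
    · rw [List.getElem?_eq_none (by rwa [length_sub hi]),
        List.getElem?_eq_none (by rwa [length_sub hj])]

theorem take_sub {i m n : ℕ} (h : m ≤ n) : (sub W i n).take m = sub W i m := by
  simp [sub, List.take_take, h]

theorem sub_zero_length : sub W 0 W.length = W := by simp [sub]

theorem append_sub_append {i n : ℕ} : W.take i ++ sub W i n ++ W.drop (i + n) = W := by
  rw [sub, List.append_assoc, ← List.drop_drop, List.take_append_drop, List.take_append_drop]

theorem sub_infix (i n : ℕ) : sub W i n <:+: W := ⟨_, _, append_sub_append⟩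

theorem eq_sub_of_append {s u t : List α} (h : s ++ u ++ t = W) :
    s.length + u.length ≤ W.length ∧ u = sub W s.length u.length := by
  subst h
  simp [sub]

theorem infix_iff {u : List α} :
    u <:+: W ↔ ∃ i, i + u.length ≤ W.length ∧ u = sub W i u.length := by
  constructor
  · rintro ⟨s, t, h⟩
    exact ⟨_, eq_sub_of_append h⟩
  · rintro ⟨i, -, h⟩
    rw [h]
    exact sub_infix _ _

theorem mem_factors {u : List α} {n : ℕ} :
    u ∈ factors W n ↔ ∃ i, i + n ≤ W.length ∧ sub W i n = u := by
  constructor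
  · rintro ⟨rfl, h⟩
    obtain ⟨i, h1, h2⟩ := infix_iff.1 h
    exact ⟨i, h1, h2.symm⟩
  · rintro ⟨i, h, rfl⟩
    exact ⟨length_sub h, sub_infix _ _⟩

theorem palindrome_sub {i n : ℕ} (h : i + n ≤ W.length) :
    (sub W i n).Palindrome ↔ PalAt (letter W) i n := by
  rw [List.Palindrome.iff_reverse_eq]
  have hrev : ∀ t < n, (sub W i n).reverse[t]? = letter W (i + (n - 1 - t)) := fun t ht => by
    rw [List.getElem?_reverse (by rwa [length_sub h]), length_sub h, getElem?_sub (by omega)]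
  constructor
  · intro hp s t hst
    rw [← getElem?_sub (n := n) (by omega), ← hp, hrev s (by omega)]
    congr 2; omega
  · intro hp
    refine List.ext_getElem? fun t => ?_
    rcases Nat.lt_or_ge t n with ht | ht
    · rw [hrev t ht, getElem?_sub ht]
      exact hp _ _ (by omega)
    · rw [List.getElem?_eq_none (by rwa [List.length_reverse, length_sub h]),
        List.getElem?_eq_none (by rwa [length_sub h])]

theorem palindrome_iff : W.Palindrome ↔ PalAt (letter W) 0 W.length := by
  rw [← palindrome_sub (by omega), sub_zero_length]

theorem sub_succ_eq_append {i n : ℕ} (h : i + n < W.length) :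
    sub W i (n + 1) = sub W i n ++ [W[i + n]] := by
  rw [sub, sub, List.take_add_one]
  simp [h]

theorem append_singleton_infix {u : List α} {a : α} : u ++ [a] <:+: W ↔
    ∃ i, i + u.length < W.length ∧ u = sub W i u.length ∧ letter W (i + u.length) = some a := by
  rw [infix_iff]
  simp only [List.length_append, List.length_singleton]
  constructor
  · rintro ⟨i, h1, h2⟩
    have h3 : i + u.length < W.length := by omega
    rw [sub_succ_eq_append h3] at h2
    obtain ⟨h4, h5⟩ := List.append_inj' h2 rfl
    refine ⟨i, h3, h4, ?_⟩
    rw [letter_eq_getElem h3]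
    simpa using h5.symm
  · rintro ⟨i, h1, h2, h3⟩
    refine ⟨i, by omega, ?_⟩
    rw [letter_eq_getElem h1] at h3
    rw [sub_succ_eq_append h1, ← h2, Option.some.inj h3]

theorem isRightSpecial_iff {u : List α} : IsRightSpecial W u ↔
    ∃ i j, Split (letter W) W.length i j u.length ∧ u = sub W i u.length := by
  constructor
  · rintro ⟨a, b, hab, ha, hb⟩
    obtain ⟨i, hi1, hi2, hi3⟩ := append_singleton_infix.1 ha
    obtain ⟨j, hj1, hj2, hj3⟩ := append_singleton_infix.1 hb
    refine ⟨i, j, ⟨hi1, hj1, (sub_eq_sub (by omega) (by omega)).1 (hi2.symm.trans hj2), ?_⟩, hi2⟩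
    rw [hi3, hj3]
    exact fun h => hab (Option.some.inj h)
  · rintro ⟨i, j, ⟨hi, hj, hag, hne⟩, hu⟩
    have hi' := letter_eq_getElem hi
    have hj' := letter_eq_getElem hj
    refine ⟨W[i + u.length], W[j + u.length], fun h => hne (by rw [hi', hj', h]), ?_, ?_⟩
    · exact append_singleton_infix.2 ⟨i, hi, hu, hi'⟩
    · exact append_singleton_infix.2
        ⟨j, hj, hu.trans ((sub_eq_sub (by omega) (by omega)).2 hag), hj'⟩

theorem exists_isRightSpecial_iff {n : ℕ} : (∃ u, u.length = n ∧ IsRightSpecial W u) ↔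
    ∃ i j, Split (letter W) W.length i j n := by
  constructor
  · rintro ⟨u, rfl, h⟩
    obtain ⟨i, j, h, -⟩ := isRightSpecial_iff.1 h
    exact ⟨i, j, h⟩
  · rintro ⟨i, j, h⟩
    have hl : (sub W i n).length = n := length_sub h.1.le
    exact ⟨sub W i n, hl, isRightSpecial_iff.2 ⟨i, j, by rwa [hl], by rw [hl]⟩⟩

theorem isUnrepeated_iff {i n : ℕ} (hi : i + n ≤ W.length) : IsUnrepeated W (sub W i n) ↔
    ∀ j, j + n ≤ W.length → Agree (letter W) j i n → j = i := by
  constructor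
  · rintro ⟨p, -, hp⟩ j hj hag
    have h1 := hp (W.take i, W.drop (i + n)) append_sub_append
    have h2 := hp (W.take j, W.drop (j + n)) (by
      simp only [← (sub_eq_sub hj hi).2 hag]; exact append_sub_append)
    have h3 := congrArg (fun p => p.1.length) (h2.trans h1.symm)
    simp only [List.length_take] at h3
    omega
  · intro h
    refine ⟨(W.take i, W.drop (i + n)), append_sub_append, ?_⟩
    rintro ⟨s, t⟩ hst
    simp only at hst
    obtain ⟨h1, h2⟩ := eq_sub_of_append hst
    rw [length_sub hi] at h1 h2
    have h3 := h s.length h1 ((sub_eq_sub h1 hi).1 h2.symm)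
    have h4 : s = W.take i := by
      rw [← h3, ← hst]; simp
    have h5 : t = W.drop (i + n) := by
      have h6 : i + n = (s ++ sub W i n).length := by rw [List.length_append, length_sub hi, h3]
      have h7 := congrArg (List.drop (i + n)) hst
      rwa [List.drop_left' h6.symm] at h7
    rw [h4, h5]

end Factors

/-! ### Counting factors: trapezoidal words have unique splits -/

section Trapezoidal

variable {α : Type*} {W : List α}

theorem lt_R_iff {n : ℕ} : n < R W ↔ ∃ i j, Split (letter W) W.length i j n := by
  have hmem : W.length ∈ {p | ¬ ∃ u : List α, u.length = p ∧ IsRightSpecial W u} := by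
    rw [Set.mem_ofPred_eq, exists_isRightSpecial_iff]
    rintro ⟨i, j, h, -⟩
    omega
  constructor
  · intro h
    have := Nat.notMem_of_lt_sInf h
    rw [Set.mem_ofPred_eq, not_not, exists_isRightSpecial_iff] at this
    exact this
  · rintro ⟨i, j, h⟩
    by_contra hle
    refine Nat.sInf_mem ⟨_, hmem⟩ (exists_isRightSpecial_iff.2 ?_)
    change ∃ i j, Split (letter W) W.length i j (R W)
    -- the suffixes of a right special factor are right special
    obtain ⟨d, rfl⟩ : ∃ d, n = d + R W := ⟨n - R W, by omega⟩
    obtain ⟨h1, h2, h3, h4⟩ := h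
    refine ⟨i + d, j + d, by omega, by omega, h3.shift le_rfl, ?_⟩
    rwa [add_assoc, add_assoc]

theorem K_le_iff {n : ℕ} (hn : n ≤ W.length) : K W ≤ n ↔
    ∀ j, j + n < W.length → ¬ Agree (letter W) j (W.length - n) n := by
  have hset : ∀ k, (∃ u : List α, u.length = k ∧ u <:+ W ∧ IsUnrepeated W u) ↔ k ≤ W.length ∧
      ∀ j, j + k < W.length → ¬ Agree (letter W) j (W.length - k) k := by
    intro k
    constructor
    · rintro ⟨u, rfl, hu, hun⟩
      refine ⟨hu.length_le, fun j hj hag => ?_⟩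
      have h1 : u = sub W (W.length - u.length) u.length := by
        rw [List.suffix_iff_eq_drop] at hu
        rw [sub, ← hu, List.take_length]
      have := (isUnrepeated_iff (W := W) (i := W.length - u.length) (n := u.length) (by omega)).1
        (by rwa [← h1]) j hj.le hag
      omega
    · rintro ⟨hk, h⟩
      refine ⟨sub W (W.length - k) k, length_sub (by omega), ?_,
        (isUnrepeated_iff (by omega)).2 fun j hj hag => ?_⟩
      · rw [sub, List.take_of_length_le (by rw [List.length_drop]; omega)]
        exact List.drop_suffix _ _
      · by_contra hne
        exact h j (by omega) hag
  have hK : K W = sInf {k | k ≤ W.length ∧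
      ∀ j, j + k < W.length → ¬ Agree (letter W) j (W.length - k) k} := by
    unfold K
    congr 1
    ext k
    exact hset k
  rw [hK]
  constructor
  · intro hle
    obtain ⟨h1, h2⟩ := Nat.sInf_mem (s := {k | k ≤ W.length ∧
      ∀ j, j + k < W.length → ¬ Agree (letter W) j (W.length - k) k})
      ⟨W.length, le_rfl, fun j hj => absurd hj (by omega)⟩
    obtain ⟨k, hk⟩ : ∃ k, k = sInf {k | k ≤ W.length ∧
      ∀ j, j + k < W.length → ¬ Agree (letter W) j (W.length - k) k} := ⟨_, rfl⟩
    rw [← hk] at hle h1 h2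
    intro j hj hag
    refine h2 (j + (n - k)) (by omega) ?_
    rw [show W.length - k = W.length - n + (n - k) by omega]
    exact hag.shift (by omega)
  · exact fun h => Nat.sInf_le ⟨hn, h⟩

theorem K_le_length : K W ≤ W.length :=
  (K_le_iff le_rfl).2 fun j hj => absurd hj (by omega)

open Classical in
/-- The finite set of factors of length `n` of `W`, for `n ≤ W.length`. -/
noncomputable def factorFinset (W : List α) (n : ℕ) : Finset (List α) :=
  (Finset.range (W.length + 1 - n)).image fun i => sub W i n

theorem mem_factorFinset {n : ℕ} (hn : n ≤ W.length) {u : List α} :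
    u ∈ factorFinset W n ↔ ∃ i, i + n ≤ W.length ∧ sub W i n = u := by
  simp only [factorFinset, Finset.mem_image, Finset.mem_range]
  refine exists_congr fun i => and_congr_left fun _ => ?_
  omega

open Classical in
/-- The right extensions of `u` among the factors of length `n + 1`. -/
noncomputable def extensions (W : List α) (n : ℕ) (u : List α) : Finset (List α) :=
  (factorFinset W (n + 1)).filter fun v => v.take n = u

/-- The number of right special factors of length `n`, each counted with the number of its right
extensions minus one. -/
noncomputable def branching (W : List α) (n : ℕ) : ℕ :=
  ∑ u ∈ factorFinset W n, ((extensions W n u).card - 1)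

theorem mem_extensions {n : ℕ} (hn : n < W.length) {u v : List α} :
    v ∈ extensions W n u ↔ ∃ i, i + n < W.length ∧ sub W i n = u ∧ sub W i (n + 1) = v := by
  simp only [extensions, Finset.mem_filter, mem_factorFinset (Nat.succ_le_of_lt hn)]
  constructor
  · rintro ⟨⟨i, h1, rfl⟩, h2⟩
    rw [take_sub (by omega)] at h2
    exact ⟨i, by omega, h2, rfl⟩
  · rintro ⟨i, h1, rfl, rfl⟩
    exact ⟨⟨i, by omega, rfl⟩, take_sub (by omega)⟩

open Classical in
theorem card_factorFinset_succ {n : ℕ} (hn : n < W.length) :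
    (factorFinset W (n + 1)).card + (if K W ≤ n then 1 else 0) =
      (factorFinset W n).card + branching W n := by
  have hmaps : ∀ v ∈ factorFinset W (n + 1), v.take n ∈ factorFinset W n := fun v hv => by
    obtain ⟨i, h1, rfl⟩ := (mem_factorFinset (Nat.succ_le_of_lt hn)).1 hv
    exact (mem_factorFinset hn.le).2 ⟨i, by omega, (take_sub (by omega)).symm⟩
  have hdead : (∑ u ∈ factorFinset W n, if extensions W n u = ∅ then 1 else 0) =
      if K W ≤ n then 1 else 0 := by
    have hlast : sub W (W.length - n) n ∈ factorFinset W n :=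
      (mem_factorFinset hn.le).2 ⟨_, by omega, rfl⟩
    rw [Finset.sum_eq_single_of_mem _ hlast]
    · refine if_congr ?_ rfl rfl
      rw [K_le_iff hn.le, Finset.eq_empty_iff_forall_notMem]
      constructor
      · intro h j hj hag
        refine h _ ((mem_extensions hn).2 ⟨j, hj, ?_, rfl⟩)
        exact (sub_eq_sub hj.le (by omega)).2 hag
      · intro h v hv
        obtain ⟨i, h1, h2, -⟩ := (mem_extensions hn).1 hv
        exact h i h1 ((sub_eq_sub h1.le (by omega)).1 h2)
    · intro u hu hne
      obtain ⟨i, h1, rfl⟩ := (mem_factorFinset hn.le).1 hu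
      refine if_neg (Finset.nonempty_iff_ne_empty.1 ⟨_, (mem_extensions hn).2 ⟨i, ?_, rfl, rfl⟩⟩)
      by_contra h
      exact hne (by congr 1; omega)
  rw [Finset.card_eq_sum_card_fiberwise (f := List.take n) hmaps, ← hdead, branching,
    Finset.card_eq_sum_ones, ← Finset.sum_add_distrib, ← Finset.sum_add_distrib]
  refine Finset.sum_congr rfl fun u _ => ?_
  change (extensions W n u).card + _ = 1 + ((extensions W n u).card - 1)
  split_ifs with h
  · simp [h]
  · have := Finset.card_pos.2 (Finset.nonempty_iff_ne_empty.2 h)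
    omega

/-- Summing the increments of the complexity from `1` (at length `0`) to `1` (at length `N`). -/
theorem sum_branching : ∑ n ∈ Finset.range W.length, branching W n + K W = W.length := by
  classical
  have h0 : (factorFinset W 0).card = 1 := by
    rw [Finset.card_eq_one]
    refine ⟨[], Finset.ext fun u => ?_⟩
    rw [mem_factorFinset (Nat.zero_le _), Finset.mem_singleton]
    exact ⟨fun ⟨i, _, h⟩ => by rw [← h]; simp [sub], fun h => ⟨0, by omega, by rw [h]; simp [sub]⟩⟩
  have hN : (factorFinset W W.length).card = 1 := by
    simp [factorFinset]
  have hstep : ∀ m ≤ W.length, (factorFinset W m).card + (m - K W) =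
      1 + ∑ n ∈ Finset.range m, branching W n := by
    intro m
    induction m with
    | zero => simp [h0]
    | succ m ih =>
      intro hm
      have h1 := ih (by omega)
      have h2 := card_factorFinset_succ (W := W) (n := m) hm
      rw [Finset.sum_range_succ]
      split_ifs at h2 <;> omega
  have := hstep _ le_rfl
  have := K_le_length (W := W)
  omega

theorem split_of_mem_extensions {n : ℕ} (hn : n < W.length) {u v v' : List α}
    (hv : v ∈ extensions W n u) (hv' : v' ∈ extensions W n u) (hne : v ≠ v') :
    ∃ i j, Split (letter W) W.length i j n ∧ sub W i n = u ∧ sub W i (n + 1) = v ∧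
      sub W j (n + 1) = v' := by
  obtain ⟨i, h1, h2, h3⟩ := (mem_extensions hn).1 hv
  obtain ⟨j, h4, h5, h6⟩ := (mem_extensions hn).1 hv'
  have hag := (sub_eq_sub h1.le h4.le).1 (h2.trans h5.symm)
  refine ⟨i, j, ⟨h1, h4, hag, fun h => hne ?_⟩, h2, h3, h6⟩
  rw [← h3, ← h6]
  exact (sub_eq_sub (by omega) (by omega)).2 (hag.succ h)

theorem one_lt_card_extensions {n i j : ℕ} (h : Split (letter W) W.length i j n) :
    1 < (extensions W n (sub W i n)).card := by
  obtain ⟨h1, h2, h3, h4⟩ := h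
  have hn : n < W.length := by omega
  refine Finset.one_lt_card.2 ⟨_, (mem_extensions hn).2 ⟨i, h1, rfl, rfl⟩, _,
    (mem_extensions hn).2 ⟨j, h2, ((sub_eq_sub h1.le h2.le).2 h3).symm, rfl⟩, fun h => h4 ?_⟩
  exact (sub_eq_sub (by omega) (by omega)).1 h n (by omega)

theorem branching_pos_iff {n : ℕ} (hn : n < W.length) :
    0 < branching W n ↔ ∃ i j, Split (letter W) W.length i j n := by
  constructor
  · intro h
    obtain ⟨u, -, hu⟩ := Finset.exists_ne_zero_of_sum_ne_zero h.ne'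
    obtain ⟨v, hv, v', hv', hne⟩ := Finset.one_lt_card.1 (show 1 < (extensions W n u).card by omega)
    obtain ⟨i, j, h, -⟩ := split_of_mem_extensions hn hv hv' hne
    exact ⟨i, j, h⟩
  · rintro ⟨i, j, h⟩
    have h1 := one_lt_card_extensions h
    have h2 : (extensions W n (sub W i n)).card - 1 ≤ branching W n :=
      Finset.single_le_sum (f := fun u => (extensions W n u).card - 1) (fun _ _ => Nat.zero_le _)
        ((mem_factorFinset hn.le).2 ⟨i, h.1.le, rfl⟩)
    omega

theorem R_le_length : R W ≤ W.length := by
  by_contra h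
  obtain ⟨i, j, h, -⟩ := lt_R_iff.1 (Nat.lt_of_not_le h)
  omega

theorem isTrapezoidal_iff_branching :
    IsTrapezoidal W ↔ ∀ n < W.length, branching W n ≤ 1 := by
  have hsum := sum_branching (W := W)
  have hR : ∑ n ∈ Finset.range W.length, (if n < R W then 1 else 0) = R W := by
    have := R_le_length (W := W)
    rw [← Finset.sum_filter, Finset.sum_const, smul_eq_mul, mul_one]
    rw [show (Finset.range W.length).filter (· < R W) = Finset.range (R W) by ext; simp; omega,
      Finset.card_range]
  have hle : ∀ n ∈ Finset.range W.length, (if n < R W then 1 else 0) ≤ branching W n := by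
    intro n hn
    split_ifs with h
    · exact (branching_pos_iff (Finset.mem_range.1 hn)).2 (lt_R_iff.1 h)
    · exact Nat.zero_le _
  have hiff := Finset.sum_eq_sum_iff_of_le hle
  rw [hR] at hiff
  have : IsTrapezoidal W ↔ R W = ∑ n ∈ Finset.range W.length, branching W n := by
    unfold IsTrapezoidal; omega
  rw [this, hiff]
  refine forall_congr' fun n => ?_
  rw [Finset.mem_range]
  refine imp_congr_right fun hn => ?_
  have hpos := branching_pos_iff (W := W) hn
  rw [← lt_R_iff] at hpos
  split_ifs with h <;> [have := hpos.2 h; have := mt hpos.1 h] <;> omega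

/-- `W` is trapezoidal if and only if it uses at most two letters and has at most one right special
factor of each length. -/
theorem isTrapezoidal_iff : IsTrapezoidal W ↔ UniqueSplits (letter W) W.length := by
  classical
  rw [isTrapezoidal_iff_branching]
  constructor
  · intro h
    constructor
    · rcases Nat.eq_zero_or_pos W.length with h0 | hpos
      · exact ⟨none, none, fun i hi => absurd hi (by omega)⟩
      by_cases hc : ∀ i < W.length, letter W i = letter W 0
      · exact ⟨letter W 0, letter W 0, fun i hi => Or.inl (hc i hi)⟩
      push Not at hc
      obtain ⟨j, hj, hj0⟩ := hc
      refine ⟨letter W 0, letter W j, fun i hi => ?_⟩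
      by_contra hcon
      push Not at hcon
      -- three letters are three extensions of the empty word
      have hmem : ∀ k < W.length, sub W k 1 ∈ extensions W 0 [] := fun k hk =>
        (mem_extensions hpos).2 ⟨k, by omega, by simp [sub], rfl⟩
      have hne : ∀ k l, k < W.length → l < W.length → letter W k ≠ letter W l →
          sub W k 1 ≠ sub W l 1 := fun k l hk hl hkl h =>
        hkl ((sub_eq_sub (by omega) (by omega)).1 h 0 (by omega))
      have h3 : 2 < (extensions W 0 []).card := Finset.two_lt_card.2
        ⟨_, hmem 0 hpos, _, hmem j hj, _, hmem i hi, hne _ _ hpos hj hj0.symm,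
          hne _ _ hpos hi hcon.1.symm, hne _ _ hj hi hcon.2.symm⟩
      have h4 : (extensions W 0 []).card - 1 ≤ branching W 0 :=
        Finset.single_le_sum (f := fun u => (extensions W 0 u).card - 1)
          (fun _ _ => Nat.zero_le _)
          ((mem_factorFinset (Nat.zero_le _)).2 ⟨0, by omega, by simp [sub]⟩)
      have := h 0 hpos
      omega
    · intro n i j i' j' hs hs'
      have hn : n < W.length := by have := hs.1; omega
      rw [← sub_eq_sub hs.1.le hs'.1.le]
      by_contra hne
      have h1 := one_lt_card_extensions hs
      have h2 := one_lt_card_extensions hs'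
      have h3 : ∑ u ∈ {sub W i n, sub W i' n}, ((extensions W n u).card - 1) ≤ branching W n := by
        refine Finset.sum_le_sum_of_subset fun u hu => ?_
        rw [Finset.mem_insert, Finset.mem_singleton] at hu
        rcases hu with rfl | rfl
        · exact (mem_factorFinset hn.le).2 ⟨i, hs.1.le, rfl⟩
        · exact (mem_factorFinset hn.le).2 ⟨i', hs'.1.le, rfl⟩
      rw [Finset.sum_pair hne] at h3
      have := h n hn
      omega
  · intro hT n hn
    by_cases h : ∃ i j, Split (letter W) W.length i j n
    · obtain ⟨i, j, hs⟩ := h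
      have hmem : sub W i n ∈ factorFinset W n := (mem_factorFinset hn.le).2 ⟨i, hs.1.le, rfl⟩
      rw [branching, Finset.sum_eq_single_of_mem _ hmem]
      · by_contra h
        obtain ⟨x, hx, y, hy, z, hz, hxy, hxz, hyz⟩ := Finset.two_lt_card.1
          (show 2 < (extensions W n (sub W i n)).card by omega)
        obtain ⟨a, b, hab⟩ := hT.binary
        obtain ⟨k, l, ⟨k1, l1, -, kl⟩, -, rfl, rfl⟩ := split_of_mem_extensions hn hx hy hxy
        obtain ⟨k', m, ⟨-, m1, -, km⟩, -, hk', rfl⟩ := split_of_mem_extensions hn hx hz hxz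
        obtain ⟨l', m', ⟨-, -, -, lm⟩, -, hl', hm'⟩ := split_of_mem_extensions hn hy hz hyz
        have hlast : ∀ {p q : ℕ}, sub W p (n + 1) = sub W q (n + 1) →
            letter W (p + n) = letter W (q + n) := fun {p q} h => by
          rw [← getElem?_sub (n := n + 1) (by omega), h, getElem?_sub (by omega)]
        rw [hlast hk'] at km
        rw [hlast hl', hlast hm'] at lm
        have := hab _ k1
        have := hab _ l1
        have := hab _ m1
        grind
      · intro u hu hne
        by_contra h
        obtain ⟨v, hv, v', hv', hvv⟩ := Finset.one_lt_card.1
          (show 1 < (extensions W n u).card by omega)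
        obtain ⟨i', j', hs', rfl, -⟩ := split_of_mem_extensions hn hv hv' hvv
        exact hne ((sub_eq_sub hs'.1.le hs.1.le).2 (hT.unique n _ _ _ _ hs' hs))
    · have := mt (branching_pos_iff hn).1 h
      omega

/-- Passing from length `n` to `n + 1` the complexity of a Sturmian word grows by one, so that it
has exactly one right special factor of length `n`. -/
theorem IsSturmian.uniqueSplits (h : IsSturmian W) : UniqueSplits (letter W) W.length := by
  obtain ⟨s, hs, k, hk⟩ := h
  have hletter : ∀ i < W.length, letter W i = some (s (k + i)) := fun i hi => by
    rw [letter_eq_getElem hi]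
    congr 1
    conv_lhs => rw [List.getElem_of_eq hk.symm]
    simp [block]
  have hfin : ∀ n, (infFactors s n).Finite := fun n =>
    Set.finite_of_ncard_ne_zero (by have := hs n; unfold infComplexity at this; omega)
  constructor
  · obtain ⟨x, y, -, hxy⟩ := Set.ncard_eq_two.1 (hs 1)
    have hex : ∀ z ∈ infFactors s 1, ∃ a, z = [a] := by
      rintro _ ⟨i, rfl⟩
      exact ⟨s i, by simp [block]⟩
    obtain ⟨a, rfl⟩ := hex x (by rw [hxy]; simp)
    obtain ⟨b, rfl⟩ := hex y (by rw [hxy]; simp)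
    refine ⟨some a, some b, fun i hi => ?_⟩
    have : block s (k + i) 1 ∈ infFactors s 1 := ⟨_, rfl⟩
    rw [hxy] at this
    rw [hletter i hi]
    simpa [block] using this
  · intro n i j i' j' hsp hsp'
    have key : ∀ i j, Split (letter W) W.length i j n → block s (k + i) n = block s (k + j) n ∧
        block s (k + i) (n + 1) ≠ block s (k + j) (n + 1) := by
      intro i j ⟨h1, h2, h3, h4⟩
      rw [block_eq_block, Ne, block_eq_block]
      rw [hletter _ h1, hletter _ h2] at h4
      refine ⟨fun t ht => ?_, fun h => h4 ?_⟩
      · have := h3 t ht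
        rw [hletter _ (by omega), hletter _ (by omega)] at this
        rw [add_assoc, add_assoc]
        exact Option.some.inj this
      · rw [← add_assoc, ← add_assoc, h n (by omega)]
    have htake : ∀ k, (block s k (n + 1)).take n = block s k n := fun k => by
      refine List.ext_getElem (by simp [block]) fun i _ _ => ?_
      simp only [block, List.getElem_take, List.getElem_ofFn]
    obtain ⟨h1, h2⟩ := key i j hsp
    obtain ⟨h3, h4⟩ := key i' j' hsp'
    have hblock : block s (k + i) n = block s (k + i') n := by
      by_contra hne
      -- two factors can be dropped without losing a prefix of length `n`
      have hsub : infFactors s n ⊆ List.take n ''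
          (infFactors s (n + 1) \ {block s (k + i) (n + 1), block s (k + i') (n + 1)}) := by
        rintro _ ⟨m, rfl⟩
        by_cases hm : block s m n = block s (k + i) n
        · refine ⟨block s (k + j) (n + 1), ⟨⟨_, rfl⟩, ?_⟩, (htake _).trans (h1.symm.trans hm.symm)⟩
          rintro (h | h)
          · exact h2 h.symm
          · refine hne ?_
            rw [h1, ← htake, Set.mem_singleton_iff.1 h, htake]
        · by_cases hm' : block s m n = block s (k + i') n
          · refine ⟨block s (k + j') (n + 1), ⟨⟨_, rfl⟩, ?_⟩,
              (htake _).trans (h3.symm.trans hm'.symm)⟩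
            rintro (h | h)
            · refine hne ?_
              rw [h3, ← htake (k + j'), h, htake]
            · exact h4 (Set.mem_singleton_iff.1 h).symm
          · refine ⟨block s m (n + 1), ⟨⟨_, rfl⟩, ?_⟩, htake m⟩
            rintro (h | h)
            · exact hm (by rw [← htake, h, htake])
            · exact hm' (by rw [← htake, Set.mem_singleton_iff.1 h, htake])
      have hpair : block s (k + i) (n + 1) ≠ block s (k + i') (n + 1) := fun h =>
        hne (by rw [← htake, h, htake])
      have c1 := Set.ncard_le_ncard hsub (((hfin (n + 1)).sdiff).image _)
      have c2 := Set.ncard_image_le (f := List.take n) ((hfin (n + 1)).sdiff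
        (t := {block s (k + i) (n + 1), block s (k + i') (n + 1)}))
      have c3 := Set.ncard_sdiff (s := {block s (k + i) (n + 1), block s (k + i') (n + 1)})
        (t := infFactors s (n + 1)) (by
          rintro _ (rfl | rfl)
          · exact ⟨_, rfl⟩
          · exact ⟨_, rfl⟩) (by simp)
      rw [Set.ncard_pair hpair] at c3
      have c4 := hs n
      have c5 := hs (n + 1)
      unfold infComplexity at c4 c5
      omega
    intro t ht
    rw [hletter _ (by have := hsp.1; omega), hletter _ (by have := hsp'.1; omega), ← add_assoc,
      ← add_assoc, block_eq_block.1 hblock t ht]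

theorem IsSturmian.isTrapezoidal (h : IsSturmian W) : IsTrapezoidal W :=
  isTrapezoidal_iff.2 h.uniqueSplits

/-- A trapezoidal palindrome is Sturmian. -/
theorem IsTrapezoidal.isSturmian [Nontrivial α] (h : IsTrapezoidal W) (hW : W.Palindrome) :
    IsSturmian W := by
  have hT := isTrapezoidal_iff.1 h
  have hN := hT.noBranch (palindrome_iff.1 hW)
  obtain ⟨a, b, hab, hletters⟩ : ∃ a b : α, a ≠ b ∧ ∀ x ∈ W, x = a ∨ x = b := by
    obtain ⟨x, y, hxy⟩ := exists_pair_ne α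
    by_contra hcon
    push Not at hcon
    obtain ⟨u, hu, -⟩ := hcon x y hxy
    obtain ⟨z, hz⟩ := exists_ne u
    obtain ⟨v, hv, hvu, -⟩ := hcon u z hz.symm
    obtain ⟨t, ht, htu, htv⟩ := hcon u v hvu.symm
    obtain ⟨a, b, hab⟩ := hT.binary
    have hmem : ∀ x ∈ W, some x = a ∨ some x = b := fun x hx => by
      obtain ⟨i, hi, rfl⟩ := List.getElem_of_mem hx
      rw [← letter_eq_getElem hi]
      exact hab i hi
    have h1 := hmem u hu
    have h2 := hmem v hv
    have h3 := hmem t ht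
    have h4 : some v ≠ some u := fun h => hvu (Option.some.inj h)
    have h5 : some t ≠ some u := fun h => htu (Option.some.inj h)
    have h6 : some t ≠ some v := fun h => htv (Option.some.inj h)
    grind
  refine isSturmian_of_balanced hab hletters (hN.balanced (a := some a) (b := some b)
    (fun h => hab (Option.some.inj h)) fun i hi => ?_)
  rw [letter_eq_getElem hi]
  rcases hletters _ (List.getElem_mem hi) with h | h
  · exact Or.inl (by rw [h])
  · exact Or.inr (by rw [h])

end Trapezoidal

/-! ### Palindromic complexity of trapezoidal palindromes -/

section PalindromicComplexity

variable {α : Type*} {W : List α}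

open Classical in
/-- The finite set of palindromic factors of length `n` of `W`, for `n ≤ W.length`. -/
noncomputable def palFinset (W : List α) (n : ℕ) : Finset (List α) :=
  (factorFinset W n).filter List.Palindrome

theorem mem_palFinset {n : ℕ} (hn : n ≤ W.length) {u : List α} :
    u ∈ palFinset W n ↔ ∃ i, i + n ≤ W.length ∧ PalAt (letter W) i n ∧ sub W i n = u := by
  simp only [palFinset, Finset.mem_filter, mem_factorFinset hn]
  constructor
  · rintro ⟨⟨i, h1, rfl⟩, h2⟩
    exact ⟨i, h1, (palindrome_sub h1).1 h2, rfl⟩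
  · rintro ⟨i, h1, h2, rfl⟩
    exact ⟨⟨i, h1, rfl⟩, (palindrome_sub h1).2 h2⟩

theorem palComplexity_eq_card {n : ℕ} (hn : n ≤ W.length) :
    palComplexity W n = (palFinset W n).card := by
  rw [palComplexity, ← Set.ncard_coe_finset]
  congr 1
  ext u
  simp only [palFinset, Finset.coe_filter, mem_factorFinset hn, Set.mem_ofPred_eq, mem_factors]

theorem palComplexity_zero : palComplexity W 0 = 1 := by
  rw [palComplexity_eq_card (Nat.zero_le _), Finset.card_eq_one]
  refine ⟨[], Finset.ext fun u => ?_⟩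
  rw [mem_palFinset (Nat.zero_le _), Finset.mem_singleton]
  constructor
  · rintro ⟨i, -, -, rfl⟩
    simp [sub]
  · rintro rfl
    exact ⟨0, by omega, fun s t h => by omega, by simp [sub]⟩

theorem palComplexity_length (hW : W.Palindrome) : palComplexity W W.length = 1 := by
  rw [palComplexity_eq_card le_rfl, Finset.card_eq_one]
  refine ⟨W, Finset.ext fun u => ?_⟩
  rw [mem_palFinset le_rfl, Finset.mem_singleton]
  constructor
  · rintro ⟨i, h, -, rfl⟩
    rw [show i = 0 by omega, sub_zero_length]
  · rintro rfl
    exact ⟨0, by omega, palindrome_iff.1 hW, sub_zero_length⟩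

theorem PalAt.inner {β : Type*} {w : ℕ → β} {i n : ℕ} (h : PalAt w i (n + 2)) :
    PalAt w (i + 1) n := fun s t hst => by
  have := h (1 + s) (1 + t) (by omega)
  rwa [← add_assoc, ← add_assoc] at this

/-- Without branching, a palindrome is determined by its length and its inner palindrome. -/
theorem NoBranch.palComplexity_add_two_le (hN : NoBranch (letter W) W.length) {n : ℕ}
    (hn : n + 2 ≤ W.length) : palComplexity W (n + 2) ≤ palComplexity W n := by
  rw [palComplexity_eq_card hn, palComplexity_eq_card (by omega)]
  have hinner : ∀ i, ((sub W i (n + 2)).drop 1).take n = sub W (i + 1) n := fun i => by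
    rw [sub, List.drop_take, List.take_take, List.drop_drop, sub]
    congr 1
    omega
  refine Finset.card_le_card_of_injOn (fun u => (u.drop 1).take n) (fun u hu => ?_) ?_
  · obtain ⟨i, h1, h2, rfl⟩ := (mem_palFinset hn).1 hu
    exact (mem_palFinset (by omega)).2 ⟨i + 1, by omega, h2.inner, (hinner i).symm⟩
  · intro u hu v hv huv
    obtain ⟨i, h1, h2, rfl⟩ := (mem_palFinset hn).1 hu
    obtain ⟨j, h3, h4, rfl⟩ := (mem_palFinset hn).1 hv
    simp only [hinner] at huv
    rw [sub_eq_sub (by omega) (by omega)] at huv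
    rw [sub_eq_sub h1 h3]
    have e1 : letter W i = letter W (i + n + 1) := h2 0 (n + 1) (by omega)
    have e2 : letter W j = letter W (j + n + 1) := h4 0 (n + 1) (by omega)
    have e3 := hN i j n (by omega) (by omega) huv h2.inner e1 e2
    refine (huv.cons e3).succ ?_
    rw [← add_assoc, ← add_assoc, ← e1, ← e2, e3]

open Classical in
/-- The length of the longest palindromic suffix of the prefix of length `e` of `w`. -/
noncomputable def longestPal {β : Type*} (w : ℕ → β) (e : ℕ) : ℕ :=
  Nat.findGreatest (fun l => PalAt w (e - l) l) e

section LongestPal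

variable {β : Type*} {w : ℕ → β}

open Classical in
theorem longestPal_le (e : ℕ) : longestPal w e ≤ e := Nat.findGreatest_le _

open Classical in
theorem palAt_longestPal (e : ℕ) : PalAt w (e - longestPal w e) (longestPal w e) :=
  Nat.findGreatest_spec (P := fun l => PalAt w (e - l) l) (Nat.zero_le e)
    (fun s t h => by omega)

theorem le_longestPal {i l : ℕ} (h : PalAt w i l) : l ≤ longestPal w (i + l) := by
  classical
  exact Nat.le_findGreatest (by omega) (by rwa [Nat.add_sub_cancel])

end LongestPal

/-- A trapezoidal palindrome is rich: it has as many palindromic factors as prefixes. The longest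
palindromic suffix of a prefix has no earlier occurrence in it, since a palindromic return would be
a longer palindromic suffix; hence each palindrome is matched to the end of its first occurrence. -/
theorem UniqueSplits.sum_palComplexity (hT : UniqueSplits (letter W) W.length)
    (hW : W.Palindrome) :
    ∑ n ∈ Finset.range (W.length + 1), palComplexity W n = W.length + 1 := by
  classical
  have hpal := palindrome_iff.1 hW
  have hdisj : ∀ m ∈ Finset.range (W.length + 1), ∀ n ∈ Finset.range (W.length + 1), m ≠ n →
      Disjoint (palFinset W m) (palFinset W n) := by
    intro m hm n hn hmn
    rw [Finset.mem_range] at hm hn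
    refine Finset.disjoint_left.2 fun u hu hu' => hmn ?_
    obtain ⟨i, h1, -, rfl⟩ := (mem_palFinset (by omega)).1 hu
    obtain ⟨j, h2, -, h3⟩ := (mem_palFinset (by omega)).1 hu'
    rw [← length_sub h1, ← h3, length_sub h2]
  have hle := fun e => longestPal_le (w := letter W) e
  have hspec := fun e => palAt_longestPal (w := letter W) e
  calc ∑ n ∈ Finset.range (W.length + 1), palComplexity W n
      = ∑ n ∈ Finset.range (W.length + 1), (palFinset W n).card :=
        Finset.sum_congr rfl fun n hn =>
          palComplexity_eq_card (by rw [Finset.mem_range] at hn; omega)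
    _ = ((Finset.range (W.length + 1)).biUnion (palFinset W)).card :=
        (Finset.card_biUnion hdisj).symm
    _ = (Finset.range (W.length + 1)).card := by
        refine (Finset.card_bij (fun e _ => sub W (e - longestPal (letter W) e)
          (longestPal (letter W) e)) ?_ ?_ ?_).symm
        · intro e he
          rw [Finset.mem_range] at he
          have := hle e
          rw [Finset.mem_biUnion]
          exact ⟨longestPal (letter W) e, Finset.mem_range.2 (by omega),
            (mem_palFinset (by omega)).2 ⟨_, by omega, hspec e, rfl⟩⟩
        · intro e he e' he' heq
          rw [Finset.mem_range] at he he'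
          wlog hlt : e < e' generalizing e e'
          · rcases Nat.eq_or_lt_of_le (Nat.le_of_not_lt hlt) with h | h
            · exact h.symm
            · exact (this e' he' e he heq.symm h).symm
          exfalso
          have h1 := hle e
          have h2 := hle e'
          have hlen : longestPal (letter W) e = longestPal (letter W) e' := by
            rw [← length_sub (W := W) (i := e - longestPal (letter W) e)
              (n := longestPal (letter W) e) (by omega), heq, length_sub (by omega)]
          obtain ⟨l, hl⟩ : ∃ l, l = longestPal (letter W) e' := ⟨_, rfl⟩
          rw [hlen] at h1 heq
          have hp' := hspec e'
          rw [← hl] at h1 h2 heq hp'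
          rw [sub_eq_sub (by omega) (by omega)] at heq
          obtain ⟨x, hx, hmax⟩ : ∃ x ∈ (Finset.range (e' - l)).filter
              (fun x => Agree (letter W) x (e' - l) l), ∀ z ∈ (Finset.range (e' - l)).filter
              (fun x => Agree (letter W) x (e' - l) l), z ≤ x :=
            Finset.exists_max_image _ id
              ⟨e - l, Finset.mem_filter.2 ⟨Finset.mem_range.2 (by omega), heq⟩⟩
          rw [Finset.mem_filter, Finset.mem_range] at hx
          have hret := hT.palAt_of_return hpal hx.1 (by omega) (hp'.congr hx.2.symm) hx.2
            (fun z h3 h4 h5 => by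
              have := hmax z (Finset.mem_filter.2 ⟨Finset.mem_range.2 h4, h5.symm.trans hx.2⟩)
              omega)
          have h3 := le_longestPal hret
          rw [show x + (e' - l + l - x) = e' by omega] at h3
          omega
        · intro u hu
          obtain ⟨l, hl, hu⟩ := Finset.mem_biUnion.1 hu
          rw [Finset.mem_range] at hl
          obtain ⟨i₀, h1, h2, rfl⟩ := (mem_palFinset (by omega)).1 hu
          have hex : ∃ i, Agree (letter W) i i₀ l := ⟨i₀, fun _ _ => rfl⟩
          obtain ⟨i, hi, hmin⟩ : ∃ i, Agree (letter W) i i₀ l ∧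
              ∀ z < i, ¬ Agree (letter W) z i₀ l :=
            ⟨Nat.find hex, Nat.find_spec hex, fun z hz => Nat.find_min hex hz⟩
          have hii : i ≤ i₀ := by
            by_contra h
            exact hmin i₀ (by omega) fun _ _ => rfl
          have hpi := h2.congr hi.symm
          have h3 := le_longestPal hpi
          have h4 := hle (i + l)
          have h5 := hspec (i + l)
          have h6 : longestPal (letter W) (i + l) = l := by
            by_contra hne
            refine hmin (i + l - longestPal (letter W) (i + l)) (by omega) fun t ht => ?_
            rw [← hi t ht, h5 t (longestPal (letter W) (i + l) - 1 - t) (by omega),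
              hpi t (l - 1 - t) (by omega)]
            congr 1
            omega
          refine ⟨i + l, Finset.mem_range.2 (by omega), ?_⟩
          rw [h6, Nat.add_sub_cancel]
          exact (sub_eq_sub (by omega) h1).2 hi
    _ = W.length + 1 := Finset.card_range _

/-- A sequence that decreases along each parity class is determined to be antisymmetric by its sum
and its values at `0`, `1` and `N`. A pair `(n, N - n)` with a sum above `2` would force all pairs
to have a sum of at least `2`, and symmetrically for a sum below `2`. -/
theorem add_reflect_eq_two {P : ℕ → ℕ} {N : ℕ} (hP : ∀ n, n + 2 ≤ N → P (n + 2) ≤ P n)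
    (h0 : P 0 = 1) (h1 : 1 ≤ N → P 1 ≤ 2) (hN : P N = 1)
    (hsum : ∑ n ∈ Finset.range (N + 1), P n = N + 1) {n : ℕ} (hn : n ≤ N) :
    P n + P (N - n) = 2 := by
  have hmono : ∀ i j, i ≤ j → j ≤ N → i % 2 = j % 2 → P j ≤ P i := by
    intro i j hij hj hpar
    obtain ⟨d, rfl⟩ : ∃ d, j = i + 2 * d := ⟨(j - i) / 2, by omega⟩
    clear hij hpar
    induction d with
    | zero => exact le_rfl
    | succ d ih => exact (hP (i + 2 * d) (by omega)).trans (ih (by omega))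
  have hev : ∀ i ≤ N, i % 2 = 0 → P i ≤ 1 := fun i hi h => by
    rw [← h0]; exact hmono 0 i (by omega) hi (by omega)
  have hodd : ∀ i ≤ N, i % 2 = 1 → P i ≤ 2 := fun i hi h =>
    (hmono 1 i (by omega) hi (by omega)).trans (h1 (by omega))
  have hge : ∀ i ≤ N, i % 2 = N % 2 → 1 ≤ P i := fun i hi h => by
    rw [← hN]; exact hmono i N hi le_rfl h
  have hsum2 : ∑ j ∈ Finset.range (N + 1), (P j + P (N - j)) =
      ∑ j ∈ Finset.range (N + 1), 2 := by
    have := Finset.sum_range_reflect P (N + 1)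
    rw [Finset.sum_add_distrib, hsum]
    simp only [Nat.add_sub_cancel] at this
    rw [this, hsum, Finset.sum_const, Finset.card_range, smul_eq_mul]
    ring
  have hpair : ∀ j ≤ N, (3 ≤ P n + P (N - n) → 2 ≤ P j + P (N - j)) ∧
      (P n + P (N - n) ≤ 1 → P j + P (N - j) ≤ 2) := by
    -- it suffices to compare pairs whose first members have the same parity
    have hsame : ∀ j ≤ N, j % 2 = n % 2 → (3 ≤ P n + P (N - n) → 2 ≤ P j + P (N - j)) ∧
        (P n + P (N - n) ≤ 1 → P j + P (N - j) ≤ 2) := by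
      intro j hj hpar
      have hcmp : (P j ≤ P n ∧ P (N - n) ≤ P (N - j)) ∨ (P n ≤ P j ∧ P (N - j) ≤ P (N - n)) := by
        rcases le_total j n with h | h
        · exact Or.inr ⟨hmono j n h hn hpar, hmono _ _ (by omega) (by omega) (by omega)⟩
        · exact Or.inl ⟨hmono n j h hj hpar.symm, hmono _ _ (by omega) (by omega) (by omega)⟩
      rcases Nat.mod_two_eq_zero_or_one N with p | p <;>
        rcases Nat.mod_two_eq_zero_or_one n with q | q
      · have a1 := hev j hj (by omega)
        have a2 := hge j hj (by omega)
        have a3 := hev (N - j) (by omega) (by omega)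
        have a4 := hge (N - j) (by omega) (by omega)
        clear hcmp
        omega
      · have a1 := hodd j hj (by omega)
        have a2 := hodd n hn q
        have a3 := hodd (N - j) (by omega) (by omega)
        have a4 := hodd (N - n) (by omega) (by omega)
        have hcmp' : (P j ≤ P (N - n) ∧ P n ≤ P (N - j)) ∨
            (P (N - n) ≤ P j ∧ P (N - j) ≤ P n) := by
          rcases le_total j (N - n) with h | h
          · exact Or.inr ⟨hmono _ _ h (by omega) (by omega),
              hmono _ _ (by omega) (by omega) (by omega)⟩
          · exact Or.inl ⟨hmono _ _ h hj (by omega), hmono _ _ (by omega) (by omega) (by omega)⟩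
        omega
      · have a1 := hev j hj (by omega)
        have a2 := hev n hn q
        have a3 := hodd (N - j) (by omega) (by omega)
        have a4 := hodd (N - n) (by omega) (by omega)
        have a5 := hge (N - j) (by omega) (by omega)
        have a6 := hge (N - n) (by omega) (by omega)
        omega
      · have a1 := hodd j hj (by omega)
        have a2 := hodd n hn q
        have a3 := hev (N - j) (by omega) (by omega)
        have a4 := hev (N - n) (by omega) (by omega)
        have a5 := hge j hj (by omega)
        have a6 := hge n hn (by omega)
        omega
    intro j hj
    by_cases hpar : j % 2 = n % 2
    · exact hsame j hj hpar
    rcases Nat.mod_two_eq_zero_or_one N with p | p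
    · -- for even `N` the pairs with even first member have the sum `2`
      rcases Nat.mod_two_eq_zero_or_one n with q | q
      · have a1 := hev n hn q
        have a2 := hge n hn (by omega)
        have a3 := hev (N - n) (by omega) (by omega)
        have a4 := hge (N - n) (by omega) (by omega)
        omega
      · have a1 := hev j hj (by omega)
        have a2 := hge j hj (by omega)
        have a3 := hev (N - j) (by omega) (by omega)
        have a4 := hge (N - j) (by omega) (by omega)
        omega
    · have := hsame (N - j) (by omega) (by omega)
      rw [show N - (N - j) = j by omega] at this
      omega
  by_contra hne
  rcases Nat.lt_or_gt_of_ne hne with h | h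
  · refine absurd hsum2 (Finset.sum_lt_sum (fun j hj => ?_) ⟨n, ?_, h⟩).ne
    · exact (hpair j (by rw [Finset.mem_range] at hj; omega)).2 (by omega)
    · exact Finset.mem_range.2 (by omega)
  · refine absurd hsum2 (Finset.sum_lt_sum (fun j hj => ?_) ⟨n, ?_, h⟩).ne'
    · exact (hpair j (by rw [Finset.mem_range] at hj; omega)).1 (by omega)
    · exact Finset.mem_range.2 (by omega)

theorem IsTrapezoidal.palComplexity_add (h : IsTrapezoidal W) (hW : W.Palindrome) {n : ℕ}
    (hn : n ≤ W.length) : palComplexity W n + palComplexity W (W.length - n) = 2 := by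
  classical
  have hT := isTrapezoidal_iff.1 h
  refine add_reflect_eq_two
    (fun n hn => (hT.noBranch (palindrome_iff.1 hW)).palComplexity_add_two_le hn)
    palComplexity_zero (fun h1 => ?_) (palComplexity_length hW) (hT.sum_palComplexity hW) hn
  have h2 := card_factorFinset_succ (W := W) (n := 0) (by omega)
  have h3 := isTrapezoidal_iff_branching.1 h 0 (by omega)
  have h4 : (factorFinset W 0).card = 1 := by simp [factorFinset, sub, Finset.image_const]
  have h5 : (palFinset W 1).card ≤ (factorFinset W 1).card := Finset.card_filter_le _ _
  rw [palComplexity_eq_card h1]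
  rw [zero_add] at h2
  omega

end PalindromicComplexity

/-! ### From palindromic complexity to unique splits -/

section Converse

variable {α : Type*} {W : List α}

theorem exists_palAt_of_palComplexity_pos {n : ℕ} (hn : n ≤ W.length)
    (h : 0 < palComplexity W n) : ∃ i, i + n ≤ W.length ∧ PalAt (letter W) i n := by
  rw [palComplexity_eq_card hn] at h
  obtain ⟨u, hu⟩ := Finset.card_pos.1 h
  obtain ⟨i, h1, h2, -⟩ := (mem_palFinset hn).1 hu
  exact ⟨i, h1, h2⟩

theorem palComplexity_pos {i n : ℕ} (hi : i + n ≤ W.length) (h : PalAt (letter W) i n) :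
    0 < palComplexity W n := by
  rw [palComplexity_eq_card (by omega)]
  exact Finset.card_pos.2 ⟨_, (mem_palFinset (by omega)).2 ⟨i, hi, h, rfl⟩⟩

theorem one_lt_palComplexity {i j n : ℕ} (hi : i + n ≤ W.length) (hj : j + n ≤ W.length)
    (h : PalAt (letter W) i n) (h' : PalAt (letter W) j n) (hne : ¬ Agree (letter W) i j n) :
    1 < palComplexity W n := by
  rw [palComplexity_eq_card (by omega)]
  exact Finset.one_lt_card.2 ⟨_, (mem_palFinset (by omega)).2 ⟨i, hi, h, rfl⟩, _,
    (mem_palFinset (by omega)).2 ⟨j, hj, h', rfl⟩, fun h => hne ((sub_eq_sub hi hj).1 h)⟩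

theorem two_lt_palComplexity {i j k n : ℕ} (hi : i + n ≤ W.length) (hj : j + n ≤ W.length)
    (hk : k + n ≤ W.length) (h : PalAt (letter W) i n) (h' : PalAt (letter W) j n)
    (h'' : PalAt (letter W) k n) (hij : ¬ Agree (letter W) i j n)
    (hik : ¬ Agree (letter W) i k n) (hjk : ¬ Agree (letter W) j k n) :
    2 < palComplexity W n := by
  rw [palComplexity_eq_card (by omega)]
  exact Finset.two_lt_card.2 ⟨_, (mem_palFinset (by omega)).2 ⟨i, hi, h, rfl⟩, _,
    (mem_palFinset (by omega)).2 ⟨j, hj, h', rfl⟩, _,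
    (mem_palFinset (by omega)).2 ⟨k, hk, h'', rfl⟩, fun h => hij ((sub_eq_sub hi hj).1 h),
    fun h => hik ((sub_eq_sub hi hk).1 h), fun h => hjk ((sub_eq_sub hj hk).1 h)⟩

theorem exists_palAt_not_agree {i n : ℕ} (hi : i + n ≤ W.length) (h : 1 < palComplexity W n) :
    ∃ j, j + n ≤ W.length ∧ PalAt (letter W) j n ∧ ¬ Agree (letter W) i j n := by
  rw [palComplexity_eq_card (by omega)] at h
  obtain ⟨u, hu, hne⟩ := Finset.exists_mem_ne h (sub W i n)
  obtain ⟨j, h1, h2, rfl⟩ := (mem_palFinset (by omega)).1 hu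
  exact ⟨j, h1, h2, fun h => hne ((sub_eq_sub hi h1).2 h).symm⟩

theorem palindrome_of_palComplexity (hB : ∀ n ≤ W.length,
    palComplexity W n + palComplexity W (W.length - n) = 2) : W.Palindrome := by
  have h := hB 0 (Nat.zero_le _)
  rw [palComplexity_zero, Nat.sub_zero] at h
  obtain ⟨i, h1, h2⟩ := exists_palAt_of_palComplexity_pos (W := W) le_rfl (by omega)
  rw [show i = 0 by omega] at h2
  exact palindrome_iff.2 h2

theorem palAt_of_length_le_one {β : Type*} {w : ℕ → β} {i n : ℕ} (hn : n ≤ 1) : PalAt w i n :=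
  fun s t hst => by rw [show s = t by omega]

theorem binary_of_palComplexity (hB : ∀ n ≤ W.length,
    palComplexity W n + palComplexity W (W.length - n) = 2) :
    ∃ a b, ∀ i < W.length, letter W i = a ∨ letter W i = b := by
  rcases Nat.eq_zero_or_pos W.length with h0 | hpos
  · exact ⟨none, none, fun i hi => absurd hi (by omega)⟩
  by_cases hc : ∀ i < W.length, letter W i = letter W 0
  · exact ⟨letter W 0, letter W 0, fun i hi => Or.inl (hc i hi)⟩
  push Not at hc
  obtain ⟨j, hj, hj0⟩ := hc
  refine ⟨letter W 0, letter W j, fun i hi => ?_⟩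
  by_contra hcon
  push Not at hcon
  have h3 := two_lt_palComplexity (W := W) (n := 1) (i := 0) (j := j) (k := i) (by omega)
    (by omega) (by omega) (palAt_of_length_le_one le_rfl) (palAt_of_length_le_one le_rfl)
    (palAt_of_length_le_one le_rfl) (fun h => hj0 (h 0 one_pos).symm)
    (fun h => hcon.1 (h 0 one_pos).symm) (fun h => hcon.2 (h 0 one_pos).symm)
  have := hB 1 hpos
  omega

/-- The block of length `n` at `i` occurs, reversed, at `N - (i + n)`. -/
theorem PalAt.mirror {β : Type*} {w : ℕ → β} {N i n t : ℕ} (hw : PalAt w 0 N) (hi : i + n ≤ N)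
    (ht : t < n) : w (N - (i + n) + t) = w (i + (n - 1 - t)) := by
  have := hw (N - (i + n) + t) (i + (n - 1 - t)) (by omega)
  simpa using this

theorem PalAt.agree_mirror {β : Type*} {w : ℕ → β} {N i n : ℕ} (hw : PalAt w 0 N)
    (hi : i + n ≤ N) (h : PalAt w i n) : Agree w i (N - (i + n)) n := fun t ht => by
  rw [hw.mirror hi ht]
  exact h _ _ (by omega)

theorem PalAt.letter_after_mirror {β : Type*} {w : ℕ → β} {N i n : ℕ} (hw : PalAt w 0 N)
    (hi : i + 1 + n ≤ N) : w (N - (i + 1 + n) + n) = w i := by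
  have := hw (N - (i + 1 + n) + n) i (by omega)
  simpa using this

/-- Suppose that the right special factor `S` of length `n` is unique, is a palindrome and occurs
as `xSx` and `ySy` with `x ≠ y`. Then each palindrome of length `n` other than `S` has a
palindromic extension different from `xSx` and `ySy`. Indeed such a palindrome `U` is not right
special, so that its interior occurrences are preceded and followed by the same letter. If there
were none, `U` would be the suffix of `W`; but the last occurrence of `S`, followed by `x` say, is
not the only occurrence of `Sx`, and the run from an earlier `Sx` repeats the end of `W`, including
`U`. -/
theorem exists_extension_of_unique {β : Type*} {w : ℕ → β} {N p q r n : ℕ} (hW : PalAt w 0 N)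
    (huniq : ∀ i j, Split w N i j n → Agree w (p + 1) i n) (hp : p + n + 2 ≤ N)
    (hq : q + n + 2 ≤ N) (hS : PalAt w (p + 1) n) (hpq : Agree w (p + 1) (q + 1) n)
    (hpp : w p = w (p + n + 1)) (hqq : w q = w (q + n + 1)) (hne : w p ≠ w q)
    (hbin : ∀ i < N, w i = w p ∨ w i = w q)
    (hr : r + n ≤ N) (hU : PalAt w r n) (hUS : ¬ Agree w (p + 1) r n) :
    ∃ r', r' + n + 2 ≤ N ∧ Agree w (r' + 1) r n ∧ PalAt w r' (n + 2) := by
  by_contra hcon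
  push Not at hcon
  have hint : ∀ z, Agree w z r n → 0 < z → z + n < N → False := by
    intro z hz hz0 hzN
    obtain ⟨r', rfl⟩ : ∃ r', z = r' + 1 := ⟨z - 1, by omega⟩
    have hpz := hU.congr hz.symm
    by_cases heq : w r' = w (r' + 1 + n)
    · refine hcon r' (by omega) hz fun s t hst => ?_
      rcases s with _ | s
      · rw [show r' + t = r' + 1 + n by omega]; exact heq
      rcases t with _ | t
      · rw [show r' + (s + 1) = r' + 1 + n by omega]; exact heq.symm
      · have := hpz s t (by omega)
        rwa [add_assoc, add_assoc, add_comm 1, add_comm 1] at this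
    · refine hUS ((huniq _ (N - (r' + 1 + n)) ⟨hzN, by omega, ?_, ?_⟩).trans hz)
      · exact hW.agree_mirror hzN.le hpz
      · rw [hW.letter_after_mirror hzN.le]
        exact Ne.symm heq
  have hsuf : Agree w (N - n) r n := by
    rcases Nat.eq_zero_or_pos r with rfl | h0
    · have := (hW.agree_mirror hr hU).symm
      rwa [zero_add] at this
    · rw [show N - n = r by
        by_contra h
        exact hint r (fun _ _ => rfl) h0 (by omega)]
      exact fun _ _ => rfl
  obtain ⟨m, ⟨hmN, hm⟩, hmax⟩ : ∃ m, (m + n ≤ N ∧ Agree w (p + 1) m n) ∧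
      ∀ z, z + n ≤ N → Agree w (p + 1) z n → z ≤ m := by
    classical
    have hex := Nat.findGreatest_spec (P := fun z => z + n ≤ N ∧ Agree w (p + 1) z n) (m := p + 1)
      (n := N) (by omega) ⟨by omega, fun _ _ => rfl⟩
    exact ⟨_, hex, fun z h1 h2 => Nat.le_findGreatest (by omega) ⟨h1, h2⟩⟩
  have hmN' : m + n < N := by
    by_contra h
    rw [show N - n = m by omega] at hsuf
    exact hUS (hm.trans hsuf)
  obtain ⟨i, him, hi, hic⟩ : ∃ i, i < m ∧ Agree w (p + 1) i n ∧ w (i + n) = w (m + n) := by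
    have key : ∀ v v', v + n + 2 ≤ N → v' + n + 2 ≤ N → Agree w (p + 1) (v + 1) n →
        Agree w (p + 1) (v' + 1) n → w v = w (v + n + 1) → w v' = w (v' + n + 1) → w v ≠ w v' →
        w (m + n) = w v → ∃ i, i < m ∧ Agree w (p + 1) i n ∧ w (i + n) = w (m + n) := by
      intro v v' hv hv' ha ha' h1 h1' hvv hc
      rcases Nat.lt_or_ge (v + 1) m with h | h
      · exact ⟨v + 1, h, ha, by rw [hc, h1]; congr 1; omega⟩
      · have hvm : v + 1 = m := le_antisymm (hmax _ (by omega) ha) h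
        have hv'm : v' + 1 < m := lt_of_le_of_ne (hmax _ (by omega) ha') fun h2 => by
          refine hvv (hc.symm.trans ?_)
          rw [h1', ← h2]
          congr 1
          omega
        have hmir := hmax (N - (v' + 1 + n)) (by omega)
          (ha'.trans (hW.agree_mirror (by omega) (hS.congr ha')))
        refine ⟨N - (v + 1 + n), by omega,
          ha.trans (hW.agree_mirror (by omega) (hS.congr ha)), ?_⟩
        rw [hW.letter_after_mirror (by omega), hc]
    rcases hbin _ hmN' with h | h
    · exact key p q hp hq (fun _ _ => rfl) hpq hpp hqq hne h
    · exact key q p hq hp hpq (fun _ _ => rfl) hqq hpp hne.symm h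
  have hprop : ∀ e, m + e + n + 1 ≤ N → Agree w (i + e) (m + e) (n + 1) := by
    intro e
    induction e with
    | zero => exact fun _ => (hi.symm.trans hm).succ hic
    | succ e ih =>
      intro he
      have h1 : Agree w (i + (e + 1)) (m + (e + 1)) n := (ih (by omega)).shift (k := 1) (by omega)
      refine h1.succ ?_
      by_contra h
      have := hmax _ (by omega) (huniq _ _ (Split.symm ⟨by omega, by omega, h1, h⟩))
      omega
  have hend := (hprop (N - (m + n + 1)) (by omega)).shift (k := 1) (m := n) (by omega)
  rw [show m + (N - (m + n + 1)) + 1 = N - n by omega] at hend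
  exact hint _ (hend.trans hsuf) (by omega) (by omega)

/-- Two right special factors of length `n + 1` extend the right special factor `S` of length `n`
by two letters `x` and `y`, and then `xSx` and `ySy` are palindromes. Hence there is no palindrome
of length `N - (n + 2)`, and so none of length `N - n`. It follows that there is a second palindrome
of length `n`, and its palindromic extension is a third palindrome of length `n + 2`. -/
theorem uniqueSplits_of_palComplexity (hB : ∀ n ≤ W.length,
    palComplexity W n + palComplexity W (W.length - n) = 2) :
    UniqueSplits (letter W) W.length := by
  have hW := palindrome_iff.1 (palindrome_of_palComplexity hB)
  have hbin := binary_of_palComplexity hB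
  refine ⟨hbin, fun n => ?_⟩
  induction n with
  | zero => exact fun i j i' j' _ _ t ht => absurd ht (by omega)
  | succ n ih =>
  intro i j i' j' hs hs'
  have hdrop : ∀ {i j}, Split (letter W) W.length i j (n + 1) →
      Split (letter W) W.length (i + 1) (j + 1) n := fun {i j} h =>
    ⟨by have := h.1; omega, by have := h.2.1; omega, h.2.2.1.shift (by omega), by
      rw [add_right_comm, add_right_comm j]
      exact h.2.2.2⟩
  have hSS := ih _ _ _ _ (hdrop hs) (hdrop hs')
  by_contra hcon
  have hne : letter W i ≠ letter W i' := fun h => hcon (hSS.cons h)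
  obtain ⟨a, b, hab⟩ := hbin
  have hbin' : ∀ k < W.length, letter W k = letter W i ∨ letter W k = letter W i' := fun k hk => by
    have h1 := hab k hk
    have h2 := hab i (by have := hs.1; omega)
    have h3 := hab i' (by have := hs'.1; omega)
    grind
  -- one of the two occurrences of each factor is followed by its first letter
  have hloop : ∀ {i j}, Split (letter W) W.length i j (n + 1) → ∃ p, p + n + 2 ≤ W.length ∧
      Agree (letter W) i p (n + 1) ∧ letter W p = letter W (p + n + 1) := by
    intro i j ⟨h1, h2, h3, h4⟩
    by_cases h : letter W i = letter W (i + (n + 1))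
    · exact ⟨i, by omega, fun _ _ => rfl, h⟩
    · refine ⟨j, by omega, h3, ?_⟩
      have e1 := hab i (by omega)
      have e2 := hab _ h1
      have e3 := hab _ h2
      have e4 := h3 0 (by omega)
      rw [add_zero, add_zero] at e4
      rw [add_assoc]
      grind
  obtain ⟨p, hp, hip, hpp⟩ := hloop hs
  obtain ⟨q, hq, hiq, hqq⟩ := hloop hs'
  have hwp : letter W i = letter W p := hip 0 (by omega)
  have hwq : letter W i' = letter W q := hiq 0 (by omega)
  rw [hwp, hwq] at hne hbin'
  have hip' : Agree (letter W) (i + 1) (p + 1) n := hip.shift (by omega)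
  have hiq' : Agree (letter W) (i' + 1) (q + 1) n := hiq.shift (by omega)
  have hpq : Agree (letter W) (p + 1) (q + 1) n := hip'.symm.trans (hSS.trans hiq')
  have huniq : ∀ k l, Split (letter W) W.length k l n → Agree (letter W) (p + 1) k n :=
    fun k l h => hip'.symm.trans (ih _ _ _ _ (hdrop hs) h)
  -- `S` is left special as well, hence equal to its reversal
  have hS : PalAt (letter W) (p + 1) n := by
    have hagree := huniq (W.length - (p + 1 + n)) (W.length - (q + 1 + n)) ⟨by omega, by omega,
      fun t ht => by
        rw [hW.mirror (by omega) ht, hW.mirror (by omega) ht]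
        exact hpq _ (by omega), by
        rw [hW.letter_after_mirror (by omega), hW.letter_after_mirror (by omega)]
        exact hne⟩
    intro s t hst
    rw [hagree s (by omega), hW.mirror (by omega) (by omega)]
    congr 1
    omega
  have hext : ∀ v, Agree (letter W) (p + 1) (v + 1) n → letter W v = letter W (v + n + 1) →
      PalAt (letter W) v (n + 2) := by
    intro v hv hvv s t hst
    rcases s with _ | s
    · rw [show v + t = v + n + 1 by omega]; exact hvv
    rcases t with _ | t
    · rw [show v + (s + 1) = v + n + 1 by omega]; exact hvv.symm
    · have := hS.congr hv s t (by omega)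
      rwa [add_assoc, add_assoc, add_comm 1, add_comm 1] at this
  have hPp := hext p (fun _ _ => rfl) hpp
  have hPq := hext q hpq hqq
  have hpq' : ¬ Agree (letter W) p q (n + 2) := fun h => hne (h 0 (by omega))
  have h2 := one_lt_palComplexity (by omega) (by omega) hPp hPq hpq'
  have hB2 := hB (n + 2) (by omega)
  have hzero : palComplexity W (W.length - n) = 0 := by
    by_contra h
    obtain ⟨k, h3, h4⟩ := exists_palAt_of_palComplexity_pos (W := W) (n := W.length - n) (by omega)
      (by omega)
    rw [show W.length - n = W.length - (n + 2) + 2 by omega] at h3 h4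
    have := palComplexity_pos (by omega) h4.inner
    omega
  have hBn := hB n (by omega)
  obtain ⟨r, hr, hU, hUS⟩ := exists_palAt_not_agree (W := W) (i := p + 1) (n := n) (by omega)
    (by omega)
  obtain ⟨r', hr', hrr, hP⟩ := exists_extension_of_unique hW huniq hp hq hS hpq hpp hqq hne hbin'
    hr hU hUS
  have := two_lt_palComplexity (by omega) (by omega) (by omega) hPp hPq hP hpq'
    (fun h => hUS (((h.shift (k := 1) (m := n) (by omega))).trans hrr))
    (fun h => hUS (hpq.trans ((h.shift (k := 1) (m := n) (by omega)).trans hrr)))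
  omega

end Converse

end Words

theorem theorem2 {α : Type*} [Nontrivial α] (W : List α) (N : ℕ) (hN : W.length = N) :
    List.TFAE [
      Words.IsSturmian W ∧ W.Palindrome,
      ∀ n : ℕ, n ≤ N → Words.palComplexity W n + Words.palComplexity W (N - n) = 2,
      Words.IsTrapezoidal W ∧ W.Palindrome] := by
  subst hN
  tfae_have 1 → 3 := fun h => ⟨h.1.isTrapezoidal, h.2⟩
  tfae_have 3 → 1 := fun h => ⟨h.1.isSturmian h.2, h.2⟩
  tfae_have 3 → 2 := fun h _ hn => h.1.palComplexity_add h.2 hn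
  tfae_have 2 → 3 := fun h => ⟨Words.isTrapezoidal_iff.2 (Words.uniqueSplits_of_palComplexity h),
    Words.palindrome_of_palComplexity h⟩
  tfae_finish
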